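/- Let $n\ge 0$ and let $\lambda=(\lambda_1\ge\lambda_2\ge\dots\ge\lambda_p>0)$ be a partition of $n$. Identify $\lambda$ with its Young diagram, whose rows have lengths $\lambda_1,\dots,\lambda_p$, and let $T_\lambda$ be the tableau obtained by filling the numbers $1,\dots,n$ into the cells in increasing order, left to right, top to bottom. Let $P_\lambda$ and $Q_\lambda$ be the subgroups of $S_n$ of the permutations that map every element of $\{1,\dots,n\}$ to an element standing in the same row, respectively the same column, of $T_\lambda$, and put $$a_\lambda=\frac1{|P_\lambda|}\sum_{g\in P_\lambda}g,\qquad b_\lambda=\frac1{|Q_\lambda|}\sum_{g\in Q_\lambda}(-1)^g g,\qquad c_\lambda=a_\lambda b_\lambda ,$$ where $(-1)^g$ is the sign of $g$. Let $V_\lambda=\mathbb C[S_n]c_\lambda$ be the Specht module. For a cell $c$ of the diagram, let $h(c)$ be the number of cells in its hook, that is, of the cells in the same column weakly below $c$ or in the same row weakly to the right of $c$. **Theorem (the hook length formula).** $$\dim_{\mathbb C} V_\lambda=\frac{n!}{\prod_{c\in\lambda}h(c)} .$$ Moreover, for every $N\ge p$, with $l_j=\lambda_j+N-j$ for $1\le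 j\le N$ (where $\lambda_j=0$ for $j>p$), $$\dim_{\mathbb C} V_\lambda=\frac{n!}{\prod_{j=1}^N l_j!}\prod_{1\le i<j\le N}(l_i-l_j).$$ -/

import Mathlib

noncomputable section

namespace SpechtHook

open Equiv

/-- The parts `λ₁ ≥ λ₂ ≥ … ≥ λ_p` of a partition of `n`, as a weakly decreasing list. -/
def partList {n : ℕ} (lam : n.Partition) : List ℕ :=
  lam.parts.sort (fun a b => b ≤ a)

theorem partList_sortedGE {n : ℕ} (lam : n.Partition) : (partList lam).SortedGE :=
  (Multiset.pairwise_sort lam.parts (fun a b => b ≤ a)).sortedGE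

/-- The Young diagram of `λ`: its cells are the pairs (row, column), numbered from `0`,
and row `i` has `λ_{i+1}` cells. -/
def diagram {n : ℕ} (lam : n.Partition) : YoungDiagram :=
  YoungDiagram.ofRowLens (partList lam) (partList_sortedGE lam)

theorem card_cellsOfRowLens (w : List ℕ) : (YoungDiagram.cellsOfRowLens w).card = w.sum := by
  induction w with
  | nil => simp [YoungDiagram.cellsOfRowLens]
  | cons a w ih =>
    rw [YoungDiagram.cellsOfRowLens, Finset.card_union_of_disjoint]
    · simp [ih]
    · rw [Finset.disjoint_left]
      rintro ⟨i, j⟩ h1 h2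
      simp at h1 h2
      omega

theorem card_diagram {n : ℕ} (lam : n.Partition) : (diagram lam).card = n := by
  have h : (partList lam).sum = n := by
    rw [← Multiset.sum_coe, partList, Multiset.sort_eq, lam.parts_sum]
  exact (card_cellsOfRowLens (partList lam)).trans h

/-- The cells of a Young diagram in the reading order: top to bottom by rows,
and left to right inside each row. -/
def readingCells (μ : YoungDiagram) : Finset (ℕ ×ₗ ℕ) :=
  μ.cells.map toLex.toEmbedding

theorem card_readingCells {n : ℕ} (lam : n.Partition) : (readingCells (diagram lam)).card = n :=
  (Finset.card_map _).trans (card_diagram lam)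

/-- The Young tableau `T_λ`: the numbers `0, …, n - 1` are filled into the cells of the diagram
in increasing order, left to right, top to bottom. `canonicalTableau lam k` is the cell that
holds `k`. -/
def canonicalTableau {n : ℕ} (lam : n.Partition) (k : Fin n) : ℕ × ℕ :=
  ofLex ((readingCells (diagram lam)).orderEmbOfFin (card_readingCells lam) k)

/-- The row subgroup of a tableau: the permutations that map every entry to an entry standing
in the same row. -/
def rowSubgroup {n : ℕ} (T : Fin n → ℕ × ℕ) : Subgroup (Perm (Fin n)) where
  carrier := {g | ∀ k, (T (g k)).1 = (T k).1}
  one_mem' := fun _ => rfl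
  mul_mem' := fun {g h} hg hh k => (hg (h k)).trans (hh k)
  inv_mem' := fun {g} hg k => by
    have h : g (g⁻¹ k) = k := g.apply_symm_apply k
    have := hg (g⁻¹ k)
    rw [h] at this
    exact this.symm

/-- The column subgroup of a tableau: the permutations that map every entry to an entry standing
in the same column. -/
def colSubgroup {n : ℕ} (T : Fin n → ℕ × ℕ) : Subgroup (Perm (Fin n)) where
  carrier := {g | ∀ k, (T (g k)).2 = (T k).2}
  one_mem' := fun _ => rfl
  mul_mem' := fun {g h} hg hh k => (hg (h k)).trans (hh k)
  inv_mem' := fun {g} hg k => by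
    have h : g (g⁻¹ k) = k := g.apply_symm_apply k
    have := hg (g⁻¹ k)
    rw [h] at this
    exact this.symm

instance decidableMemRowSubgroup {n : ℕ} (T : Fin n → ℕ × ℕ) :
    DecidablePred (fun g => g ∈ rowSubgroup T) :=
  fun g => inferInstanceAs (Decidable (∀ k, (T (g k)).1 = (T k).1))

instance decidableMemColSubgroup {n : ℕ} (T : Fin n → ℕ × ℕ) :
    DecidablePred (fun g => g ∈ colSubgroup T) :=
  fun g => inferInstanceAs (Decidable (∀ k, (T (g k)).2 = (T k).2))

/-- The Young projector `a = |P|⁻¹ ∑_{g ∈ P} g`, with `P` the row subgroup. -/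
def rowProjector {n : ℕ} (T : Fin n → ℕ × ℕ) : MonoidAlgebra ℂ (Perm (Fin n)) :=
  ((Nat.card (rowSubgroup T) : ℂ))⁻¹ •
    ∑ g : Perm (Fin n) with g ∈ rowSubgroup T, MonoidAlgebra.single g (1 : ℂ)

/-- The Young projector `b = |Q|⁻¹ ∑_{g ∈ Q} (-1)^g g`, with `Q` the column subgroup. -/
def colProjector {n : ℕ} (T : Fin n → ℕ × ℕ) : MonoidAlgebra ℂ (Perm (Fin n)) :=
  ((Nat.card (colSubgroup T) : ℂ))⁻¹ •
    ∑ g : Perm (Fin n) with g ∈ colSubgroup T,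
      MonoidAlgebra.single g (((Perm.sign g : ℤˣ) : ℤ) : ℂ)

/-- The element `c_λ = a_λ b_λ` of `ℂ[S_n]`. -/
def youngSymmetrizer {n : ℕ} (lam : n.Partition) : MonoidAlgebra ℂ (Perm (Fin n)) :=
  rowProjector (canonicalTableau lam) * colProjector (canonicalTableau lam)

/-- The Specht module `V_λ = ℂ[S_n] c_λ`, a left ideal of `ℂ[S_n]`. -/
def spechtModule {n : ℕ} (lam : n.Partition) :
    Submodule (MonoidAlgebra ℂ (Perm (Fin n))) (MonoidAlgebra ℂ (Perm (Fin n))) :=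
  Submodule.span (MonoidAlgebra ℂ (Perm (Fin n))) {youngSymmetrizer lam}

/-- The hook of a cell `c`: the cells of the diagram in the same column weakly below `c`, or
in the same row weakly to the right of `c`. -/
def hook (μ : YoungDiagram) (c : ℕ × ℕ) : Finset (ℕ × ℕ) :=
  {d ∈ μ.cells | (c.1 ≤ d.1 ∧ d.2 = c.2) ∨ (d.1 = c.1 ∧ c.2 ≤ d.2)}

/-- The length of the hook of a cell. -/
def hookLength (μ : YoungDiagram) (c : ℕ × ℕ) : ℕ :=
  (hook μ c).card

/-- The number `l_j = λ_j + N - j` (`1 ≤ j ≤ N`, with `λ_j = 0` for `j` larger than the number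
of parts). The index `j` is numbered from `0` here. -/
def shiftedPart {n : ℕ} (lam : n.Partition) (N : ℕ) (j : Fin N) : ℕ :=
  (diagram lam).rowLen j + (N - 1 - j)

end SpechtHook

end

/-!
Write `A = ℂ[S_n]` and `F_λ = n! / ∏ h(c)`. The theorem follows by squeezing `dim V_λ` between `F_λ`
and a sum of squares.

* **Upper bound.** The classical combinatorial lemma on tableaux gives `a_λ g b_λ ∈ ℂ c_λ` for all
  `g`, and for `λ ≠ μ` it shows that `a_λ A b_μ` or `a_μ A b_λ` vanishes. Since `A` is semiprime,
  the Young symmetrizers are then pairwise orthogonal with `c_λ A c_λ = ℂ c_λ`, and a matrix unit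
  argument (`sum_finrank_span_singleton_sq_le`) yields `∑_λ (dim V_λ)² ≤ dim A = n!`.
* **Lower bound.** The translates of `c_λ` indexed by the standard tableaux of shape `λ` are
  linearly independent, since their coefficients form a triangular matrix for the dominance order
  (`card_standardTableaux_le_finrank`). So `dim V_λ` is at least the number of standard tableaux.
* **The numbers `F_λ`.** In terms of the shifted row lengths `l_j`, one has
  `1 / ∏ h(c) = ∏_{i<j} (l_i - l_j) / ∏ l_j!` (`YoungDiagram.degreeWeight_shiftedRow`). Lagrange
  interpolation at the nodes `l_j` gives `F_ν = ∑ F_μ` over the diagrams `μ` obtained by removing a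
  cell from `ν`, and `(n + 1) F_μ = ∑ F_ν` over the diagrams `ν` obtained by adding a cell to `μ`.
  The first identity bounds `F_λ` by the number of standard tableaux; the two together give
  `∑_λ F_λ² = n!`.

Hence `F_λ ≤ dim V_λ` while `∑ (dim V_λ)² ≤ ∑ F_λ²`, and all these inequalities are equalities.

One combinatorial fact, `sum_le_sum_of_column_initial`, serves the first two parts: among the
placements of entries in prescribed columns, filling the columns from the top minimizes the sum of
the row indices. This single number replaces the dominance order on partitions.
-/

/-! ### Sums of squares in semiprime algebras -/

section

/-- A semisimple ring is semiprime: `x A x = 0` makes the left ideal `A x` nilpotent, so that `x`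
lies in the Jacobson radical. -/
theorem eq_zero_of_mul_mul_self_eq_zero {A : Type*} [Ring A] [IsSemisimpleRing A] {x : A}
    (hx : ∀ u, x * u * x = 0) : x = 0 := by
  have hmem : x ∈ Ideal.jacobson (⊥ : Ideal A) := by
    rw [Ideal.mem_jacobson_iff]
    intro y
    refine ⟨1 - y * x, ?_⟩
    rw [Ideal.mem_bot]
    calc (1 - y * x) * y * x + (1 - y * x) - 1 = -(y * (x * y * x)) := by noncomm_ring
      _ = 0 := by rw [hx, mul_zero, neg_zero]
  rwa [Ideal.jacobson_bot, Ring.jacobson, IsSemisimpleModule.jacobson_eq_bot, Submodule.mem_bot]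
    at hmem

section

variable {k A ι : Type*} [Field k] [Ring A] [Algebra k A]

/-- If `c A c` is the line spanned by `c`, the product `c A × A c → c A c` is a pairing with scalar
values, and semiprimeness makes it nondegenerate on the side of `A c`. Hence every basis of `A c`
has a dual family in `c A`. -/
theorem exists_dual_elements [FiniteDimensional k A] (hA : ∀ x : A, (∀ u, x * u * x = 0) → x = 0)
    {c : A} (hc : c ≠ 0) (hcc : ∀ u, ∃ r : k, c * u * c = r • c)
    {d : ℕ} (x : Module.Basis (Fin d) k (Submodule.span A {c})) :
    ∃ u : Fin d → A, ∀ s t, c * u s * (x t : A) = if s = t then c else 0 := by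
  obtain ⟨θ, hθ⟩ : ∃ θ : Module.Dual k A, θ c = 1 := by
    obtain ⟨f, hf⟩ := not_forall.mp (mt (Module.forall_dual_apply_eq_zero_iff k c).mp hc)
    exact ⟨(f c)⁻¹ • f, by simp [hf]⟩
  let Φ : A →ₗ[k] Module.Dual k (Submodule.span A {c}) :=
    { toFun := fun u => θ ∘ₗ LinearMap.mulLeft k (c * u) ∘ₗ
        (Submodule.span A {c}).subtype.restrictScalars k
      map_add' := fun u v => by ext y; simp [mul_add, add_mul, mul_assoc]
      map_smul' := fun r u => by ext y; simp [mul_assoc] }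
  have hΦ (u : A) (y : Submodule.span A {c}) : Φ u y = θ (c * u * y) := rfl
  have hscal (u : A) (y : Submodule.span A {c}) : c * u * (y : A) = Φ u y • c := by
    obtain ⟨v, hv⟩ := Submodule.mem_span_singleton.mp y.2
    obtain ⟨r, hr⟩ := hcc (u * v)
    have : c * u * (y : A) = r • c := by rw [← hv, ← hr, smul_eq_mul]; noncomm_ring
    rw [hΦ, this, map_smul, hθ, smul_eq_mul, mul_one]
  have hrange : LinearMap.range Φ = ⊤ := by
    by_contra hne
    obtain ⟨y, hy0, hy⟩ : ∃ y : Submodule.span A {c}, y ≠ 0 ∧ ∀ u, Φ u y = 0 := by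
      have h0 : (LinearMap.range Φ).dualCoannihilator ≠ ⊥ := fun h => hne <| by
        rw [← Subspace.dualCoannihilator_dualAnnihilator_eq (W := LinearMap.range Φ), h]
        simp
      obtain ⟨y, hy, hy0⟩ := Submodule.exists_mem_ne_zero_of_ne_bot h0
      refine ⟨y, hy0, fun u => ?_⟩
      rw [Submodule.mem_dualCoannihilator] at hy
      exact hy _ ⟨u, rfl⟩
    refine hy0 (Subtype.ext (hA _ fun w => ?_))
    obtain ⟨v, hv⟩ := Submodule.mem_span_singleton.mp y.2
    have h1 : c * w * (y : A) = 0 := by rw [hscal, hy, zero_smul]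
    calc (y : A) * w * y = v * (c * w * y) := by
          nth_rw 1 [← hv]; rw [smul_eq_mul]; noncomm_ring
      _ = 0 := by rw [h1, mul_zero]
  have hs (s : Fin d) : ∃ u, Φ u = x.coord s := by
    have : x.coord s ∈ LinearMap.range Φ := hrange ▸ Submodule.mem_top
    exact this
  choose u hu using hs
  refine ⟨u, fun s t => ?_⟩
  rw [hscal, hu, x.coord_apply, x.repr_self, Finsupp.single_apply, ite_smul, one_smul, zero_smul]
  simp only [eq_comm]

/-- For pairwise orthogonal elements `c i` with `c i A c i = k (c i)`, the left ideals `A (c i)`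
satisfy `∑ (dim A (c i))² ≤ dim A`. The products of a basis of `A (c i)` with a dual family in
`(c i) A` behave like matrix units, so they are linearly independent. -/
theorem sum_finrank_span_singleton_sq_le [FiniteDimensional k A] [Fintype ι]
    (hA : ∀ x : A, (∀ u, x * u * x = 0) → x = 0)
    (c : ι → A) (hc : ∀ i, c i ≠ 0) (hcc : ∀ i u, ∃ r : k, c i * u * c i = r • c i)
    (hne : ∀ i j, i ≠ j → ∀ u, c i * u * c j = 0) :
    ∑ i, Module.finrank k (Submodule.span A {c i}) ^ 2 ≤ Module.finrank k A := by
  classical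
  have hfd (i : ι) : FiniteDimensional k (Submodule.span A {c i}) :=
    inferInstanceAs (FiniteDimensional k ((Submodule.span A {c i}).restrictScalars k))
  let x (i : ι) := Module.finBasis k (Submodule.span A {c i})
  choose u hu using fun i => exists_dual_elements hA (hc i) (hcc i) (x i)
  have hz (i : ι) : ∃ z, c i * z * c i = c i := by
    by_contra! h
    refine hc i (hA _ fun w => ?_)
    obtain ⟨r, hr⟩ := hcc i w
    by_cases hr0 : r = 0
    · rw [hr, hr0, zero_smul]
    · refine absurd ?_ (h (r⁻¹ • w))
      rw [mul_smul_comm, smul_mul_assoc, hr, smul_smul, inv_mul_cancel₀ hr0, one_smul]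
  choose z hz using hz
  let d (i : ι) := Module.finrank k (Submodule.span A {c i})
  -- The element `z i` between the factors avoids having to know that `c i * c i` is not zero.
  let E : (Σ i, Fin (d i) × Fin (d i)) → A := fun p =>
    (x p.1 p.2.1 : A) * z p.1 * (c p.1 * u p.1 p.2.2)
  have hE : ∀ p q : Σ i, Fin (d i) × Fin (d i),
      (c q.1 * u q.1 q.2.1) * E p * (x q.1 q.2.2 : A) = if p = q then c q.1 else 0 := by
    rintro ⟨i, s, t⟩ ⟨j, s', t'⟩
    obtain rfl | hij := eq_or_ne i j
    · have : c i * u i s' * E ⟨i, s, t⟩ * (x i t' : A) =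
          (c i * u i s' * (x i s : A)) * z i * (c i * u i t * (x i t' : A)) := by
        simp only [E]; noncomm_ring
      simp only [this, hu]
      by_cases h1 : s' = s <;> by_cases h2 : t = t' <;> simp [h1, h2, hz, Ne.symm, eq_comm]
    · obtain ⟨v, hv⟩ := Submodule.mem_span_singleton.mp (x i s).2
      have : c j * u j s' * E ⟨i, s, t⟩ * (x j t' : A) =
          (c j * (u j s' * v) * c i) * (z i * (c i * u i t) * (x j t' : A)) := by
        simp only [E]; rw [← hv, smul_eq_mul]; noncomm_ring
      rw [this, hne j i hij.symm, zero_mul, if_neg]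
      exact fun h => hij (congrArg Sigma.fst h)
  have hli : LinearIndependent k E := by
    rw [Fintype.linearIndependent_iff]
    intro g hg q
    have h := congrArg (fun y => (c q.1 * u q.1 q.2.1) * y * (x q.1 q.2.2 : A)) hg
    simp only [Finset.mul_sum, Finset.sum_mul, mul_smul_comm, smul_mul_assoc, hE, mul_zero,
      zero_mul, smul_ite, smul_zero, Finset.sum_ite_eq', Finset.mem_univ, if_true] at h
    exact (smul_eq_zero.mp h).resolve_right (hc _)
  have := hli.fintype_card_le_finrank
  simpa [Fintype.card_sigma, d, sq] using this

end

theorem monoidAlgebra_eq_zero_of_mul_mul_self_eq_zero {G : Type*} [Group G] [Finite G]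
    {x : MonoidAlgebra ℂ G} (hx : ∀ u, x * u * x = 0) : x = 0 :=
  eq_zero_of_mul_mul_self_eq_zero hx

end

/-! ### Filling columns from the top -/

section

open Finset

/-- Among the sets of natural numbers of a given size, the initial segment has the smallest sum, and
it is the only one with that sum. -/
theorem sum_range_card_le_sum (s : Finset ℕ) :
    ∑ i ∈ range #s, i ≤ ∑ i ∈ s, i ∧ (∑ i ∈ s, i = ∑ i ∈ range #s, i → s = range #s) := by
  have hcard : #(s \ range #s) = #(range #s \ s) := by
    have h1 := card_sdiff_add_card_inter s (range #s)
    have h2 := card_sdiff_add_card_inter (range #s) s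
    rw [card_range, inter_comm] at h2
    omega
  have h1 : #(s \ range #s) * #s ≤ ∑ i ∈ s \ range #s, i := by
    rw [← smul_eq_mul]
    exact card_nsmul_le_sum _ _ _ fun i hi => by simpa using (mem_sdiff.mp hi).2
  have h2 : ∑ i ∈ range #s \ s, (i + 1) ≤ #(range #s \ s) * #s := by
    rw [← smul_eq_mul]
    exact sum_le_card_nsmul _ _ _ fun i hi => by simpa using (mem_sdiff.mp hi).1
  have h3 := sum_inter_add_sum_sdiff s (range #s) (fun i => i)
  have h4 := sum_inter_add_sum_sdiff (range #s) s (fun i => i)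
  rw [inter_comm] at h4
  rw [sum_add_distrib, sum_const, smul_eq_mul, mul_one] at h2
  rw [hcard] at h1
  refine ⟨by omega, fun h => ?_⟩
  have h0 : #(range #s \ s) = 0 := by omega
  exact (eq_of_subset_of_card_le (sdiff_eq_empty_iff_subset.mp (card_eq_zero.mp h0))
    (by simp)).symm

theorem eq_range_card_of_isLowerSet {s : Finset ℕ} (hs : ∀ i ∈ s, ∀ r < i, r ∈ s) :
    s = range #s := by
  have h : ∀ i ∈ s, i < #s := fun i hi => by
    have : range (i + 1) ⊆ s := fun r hr => by
      rcases (Nat.lt_succ_iff_lt_or_eq.mp (mem_range.mp hr)) with h | rfl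
      exacts [hs i hi r h, hi]
    simpa using card_le_card this
  exact eq_of_subset_of_card_le (fun i hi => mem_range.mpr (h i hi)) (by simp)

/-- Let `R` and `R'` place the elements of `S` in rows, with columns `C`, so that no cell is used
twice. If `R'` fills an initial segment of every column, then the sum of the row indices is smallest
for `R'`, and equality forces `R` to fill the same cells. -/
theorem sum_le_sum_of_column_initial {ι : Type*} (S : Finset ι) (R R' C : ι → ℕ)
    (hR : Set.InjOn (fun i => (R i, C i)) S) (hR' : Set.InjOn (fun i => (R' i, C i)) S)
    (hinit : ∀ i ∈ S, ∀ r < R' i, ∃ j ∈ S, R' j = r ∧ C j = C i) :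
    ∑ i ∈ S, R' i ≤ ∑ i ∈ S, R i ∧
      (∑ i ∈ S, R i = ∑ i ∈ S, R' i → ∀ i ∈ S, ∃ j ∈ S, R' j = R i ∧ C j = C i) := by
  classical
  have hinj (c : ℕ) : Set.InjOn R (S.filter (C · = c)) := fun i hi j hj h => by
    simp only [coe_filter, Set.mem_ofPred_eq] at hi hj
    exact hR hi.1 hj.1 (Prod.ext h (hi.2.trans hj.2.symm))
  have hinj' (c : ℕ) : Set.InjOn R' (S.filter (C · = c)) := fun i hi j hj h => by
    simp only [coe_filter, Set.mem_ofPred_eq] at hi hj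
    exact hR' hi.1 hj.1 (Prod.ext h (hi.2.trans hj.2.symm))
  have himg (c : ℕ) : (S.filter (C · = c)).image R' = range #(S.filter (C · = c)) := by
    rw [← card_image_of_injOn (hinj' c)]
    refine eq_range_card_of_isLowerSet fun i hi r hr => ?_
    obtain ⟨k, hk, rfl⟩ := mem_image.mp hi
    obtain ⟨j, hj, hjr, hjc⟩ := hinit k (mem_filter.mp hk).1 r hr
    exact mem_image.mpr ⟨j, mem_filter.mpr ⟨hj, hjc.trans (mem_filter.mp hk).2⟩, hjr⟩
  have hsum' (c : ℕ) : ∑ i ∈ S with C i = c, R' i = ∑ i ∈ range #(S.filter (C · = c)), i := by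
    rw [← himg, sum_image (hinj' c)]
  have hsum (c : ℕ) : ∑ i ∈ S with C i = c, R i = ∑ i ∈ (S.filter (C · = c)).image R, i := by
    rw [sum_image (hinj c)]
  have hcard (c : ℕ) : #((S.filter (C · = c)).image R) = #(S.filter (C · = c)) :=
    card_image_of_injOn (hinj c)
  have hle (c : ℕ) : ∑ i ∈ S with C i = c, R' i ≤ ∑ i ∈ S with C i = c, R i := by
    rw [hsum', hsum, ← hcard]
    exact (sum_range_card_le_sum _).1
  have hmaps : ∀ i ∈ S, C i ∈ S.image C := fun i hi => mem_image_of_mem _ hi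
  rw [← sum_fiberwise_of_maps_to hmaps R, ← sum_fiberwise_of_maps_to hmaps R']
  refine ⟨sum_le_sum fun c _ => hle c, fun h i hi => ?_⟩
  have h1 := (sum_eq_sum_iff_of_le fun c _ => hle c).mp h.symm (C i) (hmaps i hi)
  rw [hsum', hsum, ← hcard] at h1
  have h2 := (sum_range_card_le_sum _).2 h1.symm
  rw [hcard, ← himg] at h2
  have h3 : R i ∈ (S.filter (C · = C i)).image R' := by
    rw [← h2]
    exact mem_image_of_mem _ (mem_filter.mpr ⟨hi, rfl⟩)
  obtain ⟨j, hj, hjr⟩ := mem_image.mp h3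
  exact ⟨j, (mem_filter.mp hj).1, hjr, (mem_filter.mp hj).2⟩

end

/-! ### Tableaux and Young projectors -/

section

open Finset Equiv SpechtHook

/-- `T` is a tableau of shape `μ`: it places the entries `0, …, n - 1` bijectively into the cells
of `μ`, and `T k` is the cell that holds `k`. -/
structure IsTableau {n : ℕ} (T : Fin n → ℕ × ℕ) (μ : YoungDiagram) : Prop where
  injective : Function.Injective T
  mem_iff : ∀ c, c ∈ μ ↔ ∃ k, T k = c

theorem isTableau_canonicalTableau {n : ℕ} (lam : n.Partition) :
    IsTableau (canonicalTableau lam) (diagram lam) where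
  injective i j h := ((readingCells (diagram lam)).orderEmbOfFin (card_readingCells lam)).injective
    (ofLex.injective h)
  mem_iff c := by
    have h := Set.ext_iff.mp
      ((readingCells (diagram lam)).range_orderEmbOfFin (card_readingCells lam)) (toLex c)
    have h1 : toLex c ∈ (readingCells (diagram lam)) ↔ c ∈ diagram lam := by
      simp [readingCells]
    rw [← h1]
    exact h.symm

namespace IsTableau

variable {n : ℕ} {T T' S : Fin n → ℕ × ℕ} {μ ν : YoungDiagram}

theorem mem (hT : IsTableau T μ) (k : Fin n) : T k ∈ μ := (hT.mem_iff _).mpr ⟨k, rfl⟩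

theorem comp_perm (hT : IsTableau T μ) (g : Perm (Fin n)) : IsTableau (T ∘ g) μ where
  injective := hT.injective.comp g.injective
  mem_iff c := by
    rw [hT.mem_iff]
    exact ⟨fun ⟨k, hk⟩ => ⟨g⁻¹ k, by simpa using hk⟩, fun ⟨k, hk⟩ => ⟨g k, hk⟩⟩

theorem exists_perm (hT : IsTableau T μ) (hS : IsTableau S μ) : ∃ g : Perm (Fin n), S = T ∘ g := by
  choose g hg using fun k => (hT.mem_iff _).mp (hS.mem k)
  have hinj : Function.Injective g := fun i j h => hS.injective <| by rw [← hg i, ← hg j, h]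
  exact ⟨Equiv.ofBijective g (Finite.injective_iff_bijective.mp hinj), funext fun k => (hg k).symm⟩

theorem of_injective (hT : IsTableau T μ) (hS : Function.Injective S) (h : ∀ k, S k ∈ μ) :
    IsTableau S μ := by
  choose g hg using fun k => (hT.mem_iff _).mp (h k)
  have hinj : Function.Injective g := fun i j h => hS <| by rw [← hg i, ← hg j, h]
  have : S = T ∘ Equiv.ofBijective g (Finite.injective_iff_bijective.mp hinj) :=
    funext fun k => (hg k).symm
  exact this ▸ hT.comp_perm _

theorem rowLen_eq (hT : IsTableau T μ) (r : ℕ) :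
    μ.rowLen r = #{k | (T k).1 = r} := by
  rw [YoungDiagram.rowLen_eq_card, ← card_image_of_injective _ hT.injective]
  congr 1
  ext c
  simp only [YoungDiagram.mem_row_iff, hT.mem_iff, mem_image, mem_filter, mem_univ, true_and]
  constructor
  · rintro ⟨⟨k, rfl⟩, h⟩
    exact ⟨k, h, rfl⟩
  · rintro ⟨k, h, rfl⟩
    exact ⟨⟨k, rfl⟩, h⟩

theorem shape_eq_of_fst_eq (hT : IsTableau T μ) (hS : IsTableau S ν)
    (h : ∀ k, (T k).1 = (S k).1) : μ = ν := by
  have hrow (r : ℕ) : μ.rowLen r = ν.rowLen r := by simp only [hT.rowLen_eq, hS.rowLen_eq, h]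
  ext ⟨i, j⟩
  simp only [YoungDiagram.mem_cells, YoungDiagram.mem_iff_lt_rowLen, hrow]

theorem sum_fst_comp_perm (T : Fin n → ℕ × ℕ) (g : Perm (Fin n)) :
    ∑ k, (T (g k)).1 = ∑ k, (T k).1 :=
  Equiv.sum_comp g fun k => (T k).1

/-- If the rows of `T` and the columns of `S` separate the entries, then the row indices of `S` have
at most the sum of those of `T`, and the sums are equal only if placing each entry in its row of `T`
and its column of `S` is a tableau of the shape of `S`. -/
theorem sum_fst_le (hS : IsTableau S ν)
    (hinj : Function.Injective fun k => ((T k).1, (S k).2)) :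
    ∑ k, (S k).1 ≤ ∑ k, (T k).1 ∧
      (∑ k, (T k).1 = ∑ k, (S k).1 → IsTableau (fun k => ((T k).1, (S k).2)) ν) := by
  obtain ⟨h1, h2⟩ := sum_le_sum_of_column_initial univ (fun k => (T k).1) (fun k => (S k).1)
    (fun k => (S k).2) hinj.injOn (hS.injective.injOn) fun i _ r hr => by
      obtain ⟨j, hj⟩ := (hS.mem_iff (r, (S i).2)).mp
        (ν.up_left_mem hr.le le_rfl (hS.mem i))
      exact ⟨j, mem_univ _, by rw [hj], by rw [hj]⟩
  refine ⟨h1, fun h => hS.of_injective hinj fun k => ?_⟩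
  obtain ⟨j, -, hj⟩ := h2 h k (mem_univ _)
  have : ((T k).1, (S k).2) = S j := Prod.ext hj.1.symm hj.2.symm
  exact this ▸ hS.mem j

/-- If no two entries lie in one row of `T` and in one column of `g • T`, then `g` is the product of
a row permutation and a column permutation. -/
theorem exists_eq_mul (hT : IsTableau T μ) {g : Perm (Fin n)}
    (hinj : Function.Injective fun k => ((T k).1, (T (g⁻¹ k)).2)) :
    ∃ p ∈ rowSubgroup T, ∃ q ∈ colSubgroup T, p * q = g := by
  have hS := ((hT.comp_perm g⁻¹).sum_fst_le hinj).2 (sum_fst_comp_perm T g⁻¹).symm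
  obtain ⟨u, hu⟩ := hT.exists_perm hS
  have hu1 (k) : ((T k).1, (T (g⁻¹ k)).2) = T (u k) := congrFun hu k
  refine ⟨u⁻¹, inv_mem fun k => ?_, u * g, fun k => ?_, by group⟩
  · rw [← hu1]
  · rw [Perm.mul_apply, ← hu1]
    simp

/-- For tableaux of different shapes, the separation property cannot hold both ways. -/
theorem shape_eq (hT : IsTableau T μ) (hS : IsTableau S ν) {g h : Perm (Fin n)}
    (h1 : Function.Injective fun k => ((T k).1, (S (g⁻¹ k)).2))
    (h2 : Function.Injective fun k => ((S k).1, (T (h⁻¹ k)).2)) : μ = ν := by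
  have e1 := (hS.comp_perm g⁻¹).sum_fst_le h1
  have e2 := (hT.comp_perm h⁻¹).sum_fst_le h2
  simp only [Function.comp_apply] at e1 e2
  have e3 := sum_fst_comp_perm S g⁻¹
  have e4 := sum_fst_comp_perm T h⁻¹
  exact hT.shape_eq_of_fst_eq (e1.2 (by omega)) fun k => rfl

end IsTableau

section Projectors

variable {n : ℕ} (T S : Fin n → ℕ × ℕ)

theorem rowProjector_mul_single {p : Perm (Fin n)} (hp : p ∈ rowSubgroup T) :
    rowProjector T * MonoidAlgebra.single p 1 = rowProjector T := by
  rw [rowProjector, smul_mul_assoc, sum_mul]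
  congr 1
  refine sum_bij (fun g _ => g * p) (fun g hg => ?_) (fun g _ g' _ h => mul_right_cancel h)
    (fun g hg => ?_) (fun g _ => by rw [MonoidAlgebra.single_mul_single, one_mul])
  · simp only [mem_filter, mem_univ, true_and] at hg ⊢
    exact mul_mem hg hp
  · simp only [mem_filter, mem_univ, true_and] at hg
    exact ⟨g * p⁻¹, by simpa using mul_mem hg (inv_mem hp), by group⟩

theorem single_mul_colProjector {q : Perm (Fin n)} (hq : q ∈ colSubgroup T) :
    MonoidAlgebra.single q 1 * colProjector T = ((Perm.sign q : ℤ) : ℂ) • colProjector T := by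
  rw [colProjector, mul_smul_comm, mul_sum, smul_comm]
  congr 1
  rw [smul_sum]
  refine sum_bij (fun g _ => q * g) (fun g hg => ?_) (fun g _ g' _ h => mul_left_cancel h)
    (fun g hg => ?_) (fun g _ => ?_)
  · simp only [mem_filter, mem_univ, true_and] at hg ⊢
    exact mul_mem hq hg
  · simp only [mem_filter, mem_univ, true_and] at hg
    exact ⟨q⁻¹ * g, by simpa using mul_mem (inv_mem hq) hg, by group⟩
  · rw [MonoidAlgebra.single_mul_single, one_mul, MonoidAlgebra.smul_single, smul_eq_mul,
      Perm.sign_mul, Units.val_mul, Int.cast_mul, ← mul_assoc, ← Int.cast_mul, ← Units.val_mul,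
      Int.units_mul_self, Units.val_one, Int.cast_one, one_mul]

/-- A transposition inside a row of `T` whose conjugate by `g⁻¹` lies inside a column of `S` kills
the product of the projectors. -/
theorem rowProjector_mul_single_mul_colProjector_eq_zero {g : Perm (Fin n)} {i j : Fin n}
    (hij : i ≠ j) (hrow : (T i).1 = (T j).1) (hcol : (S (g⁻¹ i)).2 = (S (g⁻¹ j)).2) :
    rowProjector T * MonoidAlgebra.single g 1 * colProjector S = 0 := by
  have hp : swap i j ∈ rowSubgroup T := fun k => by
    by_cases h1 : k = i
    · rw [h1, swap_apply_left, hrow]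
    by_cases h2 : k = j
    · rw [h2, swap_apply_right, hrow]
    rw [swap_apply_of_ne_of_ne h1 h2]
  have hq : swap (g⁻¹ i) (g⁻¹ j) ∈ colSubgroup S := fun k => by
    by_cases h1 : k = g⁻¹ i
    · rw [h1, swap_apply_left, hcol]
    by_cases h2 : k = g⁻¹ j
    · rw [h2, swap_apply_right, hcol]
    rw [swap_apply_of_ne_of_ne h1 h2]
  have hconj : swap i j * g = g * swap (g⁻¹ i) (g⁻¹ j) := by
    rw [swap_apply_apply, inv_inv]; group
  have hsign : Perm.sign (swap (g⁻¹ i) (g⁻¹ j)) = -1 :=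
    Perm.sign_swap fun h => hij (g⁻¹.injective h)
  have h : rowProjector T * MonoidAlgebra.single g 1 * colProjector S =
      -(rowProjector T * MonoidAlgebra.single g 1 * colProjector S) := by
    nth_rw 1 [← rowProjector_mul_single T hp]
    have h1 : (MonoidAlgebra.single (swap i j) 1 * MonoidAlgebra.single g 1 :
        MonoidAlgebra ℂ (Perm (Fin n))) =
        MonoidAlgebra.single g 1 * MonoidAlgebra.single (swap (g⁻¹ i) (g⁻¹ j)) 1 := by
      rw [MonoidAlgebra.single_mul_single, MonoidAlgebra.single_mul_single, hconj]
    rw [mul_assoc (rowProjector T), h1, ← mul_assoc, mul_assoc _ _ (colProjector S),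
      single_mul_colProjector S hq, hsign]
    simp
  have h2 : (2 : ℂ) • (rowProjector T * MonoidAlgebra.single g 1 * colProjector S) = 0 := by
    rw [two_smul]
    nth_rw 1 [h]
    exact neg_add_cancel _
  exact (smul_eq_zero.mp h2).resolve_left two_ne_zero

variable {T S} {μ ν : YoungDiagram}

theorem exists_eq_smul_of_forall_single {G : Type*} [Group G] {a b c : MonoidAlgebra ℂ G}
    (h : ∀ g, ∃ r : ℂ, a * MonoidAlgebra.single g 1 * b = r • c) (u : MonoidAlgebra ℂ G) :
    ∃ r : ℂ, a * u * b = r • c := by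
  induction u using MonoidAlgebra.induction_linear with
  | zero => exact ⟨0, by simp⟩
  | add x y hx hy =>
    obtain ⟨r, hr⟩ := hx
    obtain ⟨s, hs⟩ := hy
    exact ⟨r + s, by rw [mul_add, add_mul, hr, hs, add_smul]⟩
  | single g z =>
    obtain ⟨r, hr⟩ := h g
    refine ⟨z * r, ?_⟩
    have : (MonoidAlgebra.single g z : MonoidAlgebra ℂ G) = z • MonoidAlgebra.single g 1 := by
      simp
    rw [this, mul_smul_comm, smul_mul_assoc, hr, smul_smul]

/-- `a u b` is a multiple of `a b`: a permutation `g` either is a product `p q` of a row and a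
column permutation, or some transposition kills `a g b`. -/
theorem rowProjector_mul_mul_colProjector (hT : IsTableau T μ)
    (u : MonoidAlgebra ℂ (Perm (Fin n))) :
    ∃ r : ℂ, rowProjector T * u * colProjector T = r • (rowProjector T * colProjector T) := by
  refine exists_eq_smul_of_forall_single (fun g => ?_) u
  by_cases hinj : Function.Injective fun k => ((T k).1, (T (g⁻¹ k)).2)
  · obtain ⟨p, hp, q, hq, rfl⟩ := hT.exists_eq_mul hinj
    refine ⟨((Perm.sign q : ℤ) : ℂ), ?_⟩
    have : (MonoidAlgebra.single (p * q) 1 : MonoidAlgebra ℂ (Perm (Fin n))) =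
        MonoidAlgebra.single p 1 * MonoidAlgebra.single q 1 := by
      rw [MonoidAlgebra.single_mul_single, one_mul]
    rw [this, ← mul_assoc, rowProjector_mul_single T hp, mul_assoc, single_mul_colProjector T hq,
      mul_smul_comm]
  · simp only [Function.Injective, not_forall, Prod.mk.injEq] at hinj
    obtain ⟨i, j, h, hij⟩ := hinj
    exact ⟨0, by rw [rowProjector_mul_single_mul_colProjector_eq_zero T T hij h.1 h.2, zero_smul]⟩

/-- For different shapes `μ` and `ν`, one of `a_μ A b_ν` and `a_ν A b_μ` vanishes. -/
theorem rowProjector_mul_mul_colProjector_eq_zero_or (hT : IsTableau T μ) (hS : IsTableau S ν)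
    (hne : μ ≠ ν) :
    (∀ u, rowProjector T * u * colProjector S = 0) ∨
      (∀ u, rowProjector S * u * colProjector T = 0) := by
  have key : ∀ T S : Fin n → ℕ × ℕ,
      (∀ g : Perm (Fin n), ¬ Function.Injective fun k => ((T k).1, (S (g⁻¹ k)).2)) →
      ∀ u, rowProjector T * u * colProjector S = 0 := fun T S h u => by
    obtain ⟨r, hr⟩ := exists_eq_smul_of_forall_single (a := rowProjector T) (b := colProjector S)
      (c := 0) (fun g => by
        have hinj := h g
        simp only [Function.Injective, not_forall, Prod.mk.injEq] at hinj
        obtain ⟨i, j, h, hij⟩ := hinj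
        exact ⟨0, by
          rw [rowProjector_mul_single_mul_colProjector_eq_zero T S hij h.1 h.2, zero_smul]⟩) u
    rw [hr, smul_zero]
  by_cases h : ∃ g : Perm (Fin n), Function.Injective fun k => ((T k).1, (S (g⁻¹ k)).2)
  · obtain ⟨g, hg⟩ := h
    exact Or.inr (key S T fun g' hg' => hne (hT.shape_eq hS hg hg'))
  · exact Or.inl (key T S (not_exists.mp h))

theorem rowProjector_mul_colProjector_eq (T : Fin n → ℕ × ℕ) :
    rowProjector T * colProjector T =
      ((Nat.card (rowSubgroup T) : ℂ)⁻¹ * (Nat.card (colSubgroup T) : ℂ)⁻¹) •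
        ∑ p with p ∈ rowSubgroup T, ∑ q with q ∈ colSubgroup T,
          MonoidAlgebra.single (p * q) ((Perm.sign q : ℤ) : ℂ) := by
  rw [rowProjector, colProjector, smul_mul_smul_comm, sum_mul_sum]
  simp only [MonoidAlgebra.single_mul_single, one_mul]

theorem exists_mul_eq_of_coeff_ne_zero {g : Perm (Fin n)}
    (hg : (rowProjector T * colProjector T).coeff g ≠ 0) :
    ∃ p ∈ rowSubgroup T, ∃ q ∈ colSubgroup T, p * q = g := by
  contrapose! hg
  rw [rowProjector_mul_colProjector_eq, MonoidAlgebra.coeff_smul_apply, MonoidAlgebra.coeff_sum,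
    Finsupp.finsetSum_apply, sum_eq_zero, smul_zero]
  intro p hp
  rw [MonoidAlgebra.coeff_sum, Finsupp.finsetSum_apply, sum_eq_zero]
  intro q hq
  rw [MonoidAlgebra.coeff_single, Finsupp.single_eq_of_ne]
  exact (hg p (by simpa using hp) q (by simpa using hq)).symm

theorem coeff_one_rowProjector_mul_colProjector_ne_zero (hT : Function.Injective T) :
    (rowProjector T * colProjector T).coeff 1 ≠ 0 := by
  have h0 : ∑ p with p ∈ rowSubgroup T, ∑ q with q ∈ colSubgroup T,
      (MonoidAlgebra.single (p * q) ((Perm.sign q : ℤ) : ℂ)).coeff 1 = 1 := by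
    have hp1 : (1 : Perm (Fin n)) ∈ ({p | p ∈ rowSubgroup T} : Finset (Perm (Fin n))) := by
      simp
    have hq1 : (1 : Perm (Fin n)) ∈ ({p | p ∈ colSubgroup T} : Finset (Perm (Fin n))) := by
      simp
    have key (p q : Perm (Fin n)) (hp : p ∈ rowSubgroup T) (hq : q ∈ colSubgroup T)
        (h : p * q = 1) : q = 1 := by
      ext1 k
      have h1 : p (q k) = k := by rw [← Perm.mul_apply, h, Perm.one_apply]
      have h2 := hp (q k)
      rw [h1] at h2
      exact hT (Prod.ext h2.symm (hq k))
    rw [sum_eq_single_of_mem 1 hp1, sum_eq_single_of_mem 1 hq1]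
    · simp
    · intro q hq hne
      rw [MonoidAlgebra.coeff_single, Finsupp.single_eq_of_ne]
      exact fun h => hne (key 1 q (one_mem _) (by simpa using hq) h.symm)
    · intro p hp hne
      refine sum_eq_zero fun q hq => ?_
      rw [MonoidAlgebra.coeff_single, Finsupp.single_eq_of_ne]
      intro h
      have h1 := key p q (by simpa using hp) (by simpa using hq) h.symm
      rw [h1, mul_one] at h
      exact hne h.symm
  rw [rowProjector_mul_colProjector_eq, MonoidAlgebra.coeff_smul_apply, MonoidAlgebra.coeff_sum,
    Finsupp.finsetSum_apply]
  simp only [MonoidAlgebra.coeff_sum, Finsupp.finsetSum_apply]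
  rw [h0, smul_eq_mul, mul_one]
  exact mul_ne_zero (inv_ne_zero (Nat.cast_ne_zero.mpr Nat.card_pos.ne'))
    (inv_ne_zero (Nat.cast_ne_zero.mpr Nat.card_pos.ne'))

end Projectors

end

/-! ### Standard tableaux and Specht modules -/

section

open Finset Equiv SpechtHook

/-- Adding the entries one by one, each initial stage of the filling is a Young diagram; for a
tableau this says that the entries increase along rows and columns. -/
def IsStandard {n : ℕ} (t : Fin n → ℕ × ℕ) : Prop :=
  ∀ k, ∀ d ≤ t k, ∃ j ≤ k, t j = d

open Classical in
/-- The standard Young tableaux of shape `μ` with `n` entries. -/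
noncomputable def standardTableaux (n : ℕ) (μ : YoungDiagram) : Finset (Fin n → ℕ × ℕ) :=
  {t ∈ Fintype.piFinset fun _ => μ.cells | IsTableau t μ ∧ IsStandard t}

theorem mem_standardTableaux {n : ℕ} {μ : YoungDiagram} {t : Fin n → ℕ × ℕ} :
    t ∈ standardTableaux n μ ↔ IsTableau t μ ∧ IsStandard t := by
  classical
  rw [standardTableaux, mem_filter, Fintype.mem_piFinset]
  exact ⟨fun h => h.2, fun h => ⟨fun k => h.1.mem k, h⟩⟩

variable {n : ℕ} {T t t' : Fin n → ℕ × ℕ} {μ : YoungDiagram}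

theorem eq_of_sum_Iic_eq {f g : Fin n → ℕ} (h : ∀ m, ∑ k ∈ Iic m, f k = ∑ k ∈ Iic m, g k) :
    f = g := by
  funext m
  induction m using WellFoundedLT.induction with
  | ind m ih =>
    have hm := h m
    rw [← Iio_insert, sum_insert (by simp), sum_insert (by simp),
      sum_congr rfl fun k hk => ih k (mem_Iio.mp hk)] at hm
    exact Nat.add_right_cancel hm

/-- The entries of one row of a standard tableau stand in increasing order. -/
theorem IsStandard.eq_of_fst_eq (ht : IsTableau t μ) (hs : IsStandard t) (ht' : IsTableau t' μ)
    (hs' : IsStandard t') (h : ∀ k, (t k).1 = (t' k).1) : t = t' := by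
  have aux : ∀ {t t' : Fin n → ℕ × ℕ}, Function.Injective t → IsStandard t' →
      (∀ k, (t k).1 = (t' k).1) → ∀ k, (∀ j < k, t j = t' j) → (t' k).2 ≤ (t k).2 := by
    intro t t' ht hs' h k ih
    by_contra! hlt
    obtain ⟨j, hjk, hj⟩ := hs' k (t k) (Prod.mk_le_mk.mpr ⟨(h k).le, hlt.le⟩)
    rcases hjk.lt_or_eq with hlt' | rfl
    · exact hlt'.ne (ht ((ih j hlt').trans hj))
    · rw [hj] at hlt
      exact hlt.false
  funext k
  induction k using WellFoundedLT.induction with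
  | ind k ih =>
    exact Prod.ext (h k) (le_antisymm
      (aux ht'.injective hs (fun k => (h k).symm) k fun j hj => (ih j hj).symm)
      (aux ht.injective hs' h k ih))

/-- Dominance of prefixes: if row permutations followed by column permutations carry the tableau
`t` to a standard tableau `t'`, then every initial stage of `t'` sits weakly higher than that of
`t`. -/
theorem sum_Iic_fst_le (hT : Function.Injective T) {g g' p q : Perm (Fin n)}
    (ht : t = T ∘ ⇑(g⁻¹)) (ht' : t' = T ∘ ⇑(g'⁻¹)) (hs' : IsStandard t')
    (hp : p ∈ rowSubgroup T) (hq : q ∈ colSubgroup T) (hpq : p * q = g⁻¹ * g') (m : Fin n) :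
    ∑ k ∈ Iic m, (t' k).1 ≤ ∑ k ∈ Iic m, (t k).1 := by
  have hg' : g'⁻¹ = q⁻¹ * (p⁻¹ * g⁻¹) := by
    rw [← mul_inv_rev, ← mul_inv_rev, mul_assoc, hpq, mul_inv_cancel_left]
  have hrc (k : Fin n) : ((t k).1, (t' k).2) = T ((p⁻¹ * g⁻¹) k) := by
    refine Prod.ext ?_ ?_
    · rw [ht]
      exact (inv_mem hp (g⁻¹ k)).symm
    · rw [ht', hg']
      exact inv_mem hq ((p⁻¹ * g⁻¹) k)
  refine (sum_le_sum_of_column_initial (Iic m) (fun k => (t k).1) (fun k => (t' k).1)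
    (fun k => (t' k).2) ?_ ?_ ?_).1
  · refine Function.Injective.injOn fun i j hij => ?_
    simp only [hrc] at hij
    exact (p⁻¹ * g⁻¹).injective (hT hij)
  · refine Function.Injective.injOn fun i j hij => ?_
    rw [ht'] at hij
    exact g'⁻¹.injective (hT hij)
  · intro i hi r hr
    obtain ⟨j, hji, hj⟩ := hs' i (r, (t' i).2) (Prod.mk_le_mk.mpr ⟨hr.le, le_rfl⟩)
    exact ⟨j, mem_Iic.mpr (hji.trans (mem_Iic.mp hi)), by rw [hj], by rw [hj]⟩

/-- The translates of the Young symmetrizer that are indexed by the standard tableaux are linearly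
independent: their matrix of coefficients is triangular for the dominance order. -/
theorem card_standardTableaux_le_finrank (hT : IsTableau T μ) :
    #(standardTableaux n μ) ≤
      Module.finrank ℂ (Submodule.span (MonoidAlgebra ℂ (Perm (Fin n)))
        {rowProjector T * colProjector T}) := by
  set c := rowProjector T * colProjector T with hc
  have hex (t : standardTableaux n μ) : ∃ g : Perm (Fin n), t.1 = T ∘ ⇑(g⁻¹) := by
    obtain ⟨g, hg⟩ := hT.exists_perm (mem_standardTableaux.mp t.2).1
    exact ⟨g⁻¹, by rw [inv_inv, hg]⟩
  choose g hg using hex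
  have htri (s t : standardTableaux n μ)
      (h : (MonoidAlgebra.single (g s) (1 : ℂ) * c).coeff (g t) ≠ 0) (m : Fin n) :
      ∑ k ∈ Iic m, (t.1 k).1 ≤ ∑ k ∈ Iic m, (s.1 k).1 := by
    rw [MonoidAlgebra.coeff_single_mul_apply, one_mul, hc] at h
    obtain ⟨p, hp, q, hq, hpq⟩ := exists_mul_eq_of_coeff_ne_zero h
    exact sum_Iic_fst_le hT.injective (hg s) (hg t) (mem_standardTableaux.mp t.2).2 hp hq hpq m
  let v (t : standardTableaux n μ) :
      Submodule.span (MonoidAlgebra ℂ (Perm (Fin n))) {c} :=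
    ⟨MonoidAlgebra.single (g t) 1 * c,
      Submodule.smul_mem _ _ (Submodule.mem_span_singleton_self c)⟩
  have hli : LinearIndependent ℂ v := by
    rw [Fintype.linearIndependent_iff]
    intro z hz
    by_contra! hne
    let Φ (t : standardTableaux n μ) : ℕ := ∑ m, ∑ k ∈ Iic m, (t.1 k).1
    obtain ⟨t, ht, hmax⟩ := exists_max_image {t | z t ≠ 0} Φ
      (by obtain ⟨i, hi⟩ := hne; exact ⟨i, by simpa using hi⟩)
    have hz' : ∑ s, z s • (MonoidAlgebra.single (g s) (1 : ℂ) * c) = 0 := by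
      have := congrArg Subtype.val hz
      simpa [v] using this
    have h0 := congrArg (fun x => x.coeff (g t)) hz'
    simp only [MonoidAlgebra.coeff_sum, Finsupp.finsetSum_apply, MonoidAlgebra.coeff_smul_apply,
      MonoidAlgebra.coeff_zero, Finsupp.zero_apply] at h0
    rw [sum_eq_single_of_mem t (mem_univ t)] at h0
    · rw [MonoidAlgebra.coeff_single_mul_apply, inv_mul_cancel, one_mul, smul_eq_mul] at h0
      exact (mul_ne_zero (by simpa using ht)
        (coeff_one_rowProjector_mul_colProjector_ne_zero hT.injective)) h0
    · intro s _ hst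
      by_contra hsne
      rw [smul_eq_mul, ← ne_eq, mul_ne_zero_iff] at hsne
      have hle := htri s t hsne.2
      have hΦ : Φ t = Φ s := le_antisymm (sum_le_sum fun m _ => hle m)
        (hmax s (by simpa using hsne.1))
      have heq : (fun k => (t.1 k).1) = fun k => (s.1 k).1 := eq_of_sum_Iic_eq fun m =>
        (sum_eq_sum_iff_of_le fun m _ => hle m).mp hΦ m (mem_univ m)
      have hs := mem_standardTableaux.mp s.2
      have ht := mem_standardTableaux.mp t.2
      exact hst (Subtype.ext (hs.2.eq_of_fst_eq hs.1 ht.1 ht.2 fun k => (congrFun heq k).symm))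
  have : FiniteDimensional ℂ (Submodule.span (MonoidAlgebra ℂ (Perm (Fin n))) {c}) :=
    inferInstanceAs (FiniteDimensional ℂ
      ((Submodule.span (MonoidAlgebra ℂ (Perm (Fin n))) {c}).restrictScalars ℂ))
  simpa using hli.fintype_card_le_finrank

theorem diagram_injective : Function.Injective (diagram (n := n)) := by
  intro lam lam' h
  have key (lam : n.Partition) : lam.parts = ((diagram lam).rowLens : Multiset ℕ) := by
    rw [diagram, YoungDiagram.rowLens_ofRowLens_eq_self, partList, Multiset.sort_eq]
    intro x hx
    exact lam.parts_pos (by simpa [partList] using hx)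
  exact Nat.Partition.ext (by rw [key, key, h])

theorem exists_diagram_eq (hμ : μ.card = n) : ∃ lam : n.Partition, diagram lam = μ := by
  have hsum : (μ.rowLens : Multiset ℕ).sum = n := by
    rw [Multiset.sum_coe, ← card_cellsOfRowLens, ← hμ]
    exact congrArg YoungDiagram.card (YoungDiagram.ofRowLens_to_rowLens_eq_self (μ := μ))
  refine ⟨⟨μ.rowLens, fun {i} hi => μ.pos_of_mem_rowLens i (by simpa using hi), hsum⟩, ?_⟩
  have : partList (n := n) ⟨μ.rowLens, fun {i} hi => μ.pos_of_mem_rowLens i (by simpa using hi),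
      hsum⟩ = μ.rowLens :=
    (Multiset.coe_sort _ _).trans (List.mergeSort_eq_self _
      (by simpa using μ.rowLens_sorted.pairwise))
  simp only [diagram, this]
  exact YoungDiagram.ofRowLens_to_rowLens_eq_self

/-- The Young symmetrizers are pairwise orthogonal and satisfy `c A c = ℂ c`. For `λ ≠ λ'` the
combinatorial lemma makes one of `c_λ A c_λ'` and `c_λ' A c_λ` vanish; then so does the other one,
because the group algebra is semiprime. -/
theorem sum_finrank_spechtModule_sq_le (n : ℕ) :
    ∑ lam : n.Partition, Module.finrank ℂ (spechtModule lam) ^ 2 ≤ n.factorial := by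
  have hT (lam : n.Partition) := isTableau_canonicalTableau lam
  have hsemi (x : MonoidAlgebra ℂ (Perm (Fin n))) (hx : ∀ u, x * u * x = 0) : x = 0 :=
    monoidAlgebra_eq_zero_of_mul_mul_self_eq_zero hx
  have hfin : Module.finrank ℂ (MonoidAlgebra ℂ (Perm (Fin n))) = n.factorial := by
    rw [(MonoidAlgebra.coeffLinearEquiv ℂ).finrank_eq, Module.finrank_finsupp_self,
      Fintype.card_perm, Fintype.card_fin]
  rw [← hfin]
  have hzero (lam lam' : n.Partition)
      (h : ∀ u, rowProjector (canonicalTableau lam) * u *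
        colProjector (canonicalTableau lam') = 0) (u) :
      youngSymmetrizer lam * u * youngSymmetrizer lam' = 0 := by
    have := h (colProjector (canonicalTableau lam) * u * rowProjector (canonicalTableau lam'))
    simpa only [youngSymmetrizer, mul_assoc] using this
  refine sum_finrank_span_singleton_sq_le hsemi youngSymmetrizer (fun lam h => ?_)
    (fun lam u => ?_) fun lam lam' hne u => ?_
  · have := coeff_one_rowProjector_mul_colProjector_ne_zero (hT lam).injective
    rw [← youngSymmetrizer, h] at this
    exact this rfl
  · obtain ⟨r, hr⟩ := rowProjector_mul_mul_colProjector (hT lam)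
      (colProjector (canonicalTableau lam) * u * rowProjector (canonicalTableau lam))
    exact ⟨r, by simpa only [youngSymmetrizer, mul_assoc] using hr⟩
  · rcases rowProjector_mul_mul_colProjector_eq_zero_or (hT lam) (hT lam')
      (fun h => hne (diagram_injective h)) with h | h
    · exact hzero lam lam' h u
    · refine hsemi _ fun w => ?_
      have := hzero lam' lam h w
      calc youngSymmetrizer lam * u * youngSymmetrizer lam' * w *
            (youngSymmetrizer lam * u * youngSymmetrizer lam')
          = youngSymmetrizer lam * u * (youngSymmetrizer lam' * w * youngSymmetrizer lam) *
            (u * youngSymmetrizer lam') := by noncomm_ring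
        _ = 0 := by rw [this, mul_zero, zero_mul]

end

/-! ### Lagrange interpolation and difference products -/

section

open Finset

section Lagrange

open Polynomial

variable {ι K : Type*} [DecidableEq ι] [Field K]

/-- The leading coefficient of the monic polynomial `∏_{j ∈ t} (X + a - w_j)` by Lagrange
interpolation. -/
theorem sum_prod_sub_div_eq_one {s t : Finset ι} {v : ι → K} (hv : Set.InjOn v s)
    (a : K) (w : ι → K) (hst : #s = #t + 1) :
    ∑ i ∈ s, (∏ j ∈ t, (v i + a - w j)) / ∏ j ∈ s.erase i, (v i - v j) = 1 := by
  have hmonic : (∏ j ∈ t, (X - C (w j - a))).Monic := monic_prod_of_monic _ _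
    fun j _ => monic_X_sub_C _
  have hdeg : (∏ j ∈ t, (X - C (w j - a))).degree = ((#t : ℕ) : WithBot ℕ) := by
    rw [degree_prod, sum_congr rfl fun j _ => degree_X_sub_C (w j - a)]
    simp
  have h := Lagrange.leadingCoeff_eq_sum hv (P := ∏ j ∈ t, (X - C (w j - a)))
    (by rw [hdeg, hst]; rfl)
  rw [hmonic.leadingCoeff] at h
  refine Eq.trans (sum_congr rfl fun i _ => ?_) h.symm
  rw [eval_prod]
  congr 1
  exact prod_congr rfl fun j _ => by rw [eval_sub, eval_X, eval_C]; ring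

theorem sum_prod_add_one_sub_div_eq_one {s : Finset ι} {v : ι → K} (hv : Set.InjOn v s)
    {k : ι} (hk : k ∈ s) (hvk : v k = 0) (h0 : ∀ i ∈ s, v i + 1 ≠ 0) :
    ∑ i ∈ s, (∏ j ∈ s.erase i, (v i + 1 - v j)) / (∏ j ∈ s.erase i, (v i - v j)) / (v i + 1) =
      1 := by
  refine Eq.trans (sum_congr rfl fun i hi => ?_) (sum_prod_sub_div_eq_one hv 1 v (t := s.erase k)
    (by rw [card_erase_of_mem hk]; have := card_pos.mpr ⟨k, hk⟩; omega))
  have h1 := mul_prod_erase s (fun j => v i + 1 - v j) hi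
  have h2 := mul_prod_erase s (fun j => v i + 1 - v j) hk
  rw [← h1, hvk, sub_zero, add_sub_cancel_left, one_mul] at h2
  rw [← h2]
  field_simp [h0 i hi]

theorem sum_mul_prod_sub_one_sub_div {s : Finset ι} {v : ι → K} (hv : Set.InjOn v s) :
    ∑ i ∈ s, v i * ((∏ j ∈ s.erase i, (v i - 1 - v j)) / ∏ j ∈ s.erase i, (v i - v j)) =
      ∑ i ∈ s, v i - ((#s).choose 2 : K) := by
  -- The induction runs with the full products, which contain the factor `-1` for `j = i`.
  have key : ∀ s : Finset ι, Set.InjOn v s →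
      ∑ i ∈ s, (∏ j ∈ s, (v i + -1 - v j)) / (∏ j ∈ s.erase i, (v i - v j)) = -(#s : K) ∧
      ∑ i ∈ s, v i * ((∏ j ∈ s, (v i + -1 - v j)) / ∏ j ∈ s.erase i, (v i - v j)) =
        ((#s).choose 2 : K) - ∑ i ∈ s, v i := by
    intro s
    induction s using Finset.induction_on with
    | empty => simp
    | insert k s hk ih =>
      intro hv
      obtain ⟨ih1, ih2⟩ := ih (hv.mono (by simp))
      have h1 := sum_prod_sub_div_eq_one hv (-1) v (card_insert_of_notMem hk)
      have hne : ∀ i ∈ s, v i - v k ≠ 0 := fun i hi h => hk <| by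
        have := hv (by simp [hi]) (by simp) (sub_eq_zero.mp h)
        exact this ▸ hi
      have h2 (f : ι → K) : ∑ i ∈ insert k s, f i * (v i - v k) *
          ((∏ j ∈ s, (v i + -1 - v j)) / ∏ j ∈ (insert k s).erase i, (v i - v j)) =
          ∑ i ∈ s, f i * ((∏ j ∈ s, (v i + -1 - v j)) / ∏ j ∈ s.erase i, (v i - v j)) := by
        rw [sum_insert hk, sub_self, mul_zero, zero_mul, zero_add]
        refine sum_congr rfl fun i hi => ?_
        have hik : k ≠ i := fun h => hk (h ▸ hi)
        rw [erase_insert_of_ne hik, prod_insert (fun h => hk (mem_of_mem_erase h)),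
          mul_assoc, ← mul_div_assoc (v i - v k), mul_div_mul_left _ _ (hne i hi)]
      have h3 := h2 fun _ => 1
      have h4 := h2 v
      simp only [one_mul] at h3
      rw [ih1] at h3
      rw [ih2] at h4
      have h5 (i : ι) : ∏ j ∈ insert k s, (v i + -1 - v j) =
          (v i - v k) * (∏ j ∈ s, (v i + -1 - v j)) - ∏ j ∈ s, (v i + -1 - v j) := by
        rw [prod_insert hk]; ring
      constructor
      · simp only [h5, sub_div, mul_div_assoc, sum_sub_distrib, h1, h3, card_insert_of_notMem hk]
        push_cast
        ring
      · have h6 : ∑ i ∈ insert k s, v i *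
            ((∏ j ∈ s, (v i + -1 - v j)) / ∏ j ∈ (insert k s).erase i, (v i - v j)) =
            -(#s : K) + v k := by
          have hvk : v k = ∑ i ∈ insert k s, v k *
              ((∏ j ∈ s, (v i + -1 - v j)) / ∏ j ∈ (insert k s).erase i, (v i - v j)) := by
            rw [← mul_sum, h1, mul_one]
          refine Eq.trans ?_ (congrArg₂ (· + ·) h3 hvk.symm)
          rw [← sum_add_distrib]
          exact sum_congr rfl fun i _ => by ring
        have h7 (i : ι) (y : K) : v i * (((v i - v k) * (∏ j ∈ s, (v i + -1 - v j)) -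
            ∏ j ∈ s, (v i + -1 - v j)) / y) = v i * (v i - v k) *
            ((∏ j ∈ s, (v i + -1 - v j)) / y) - v i * ((∏ j ∈ s, (v i + -1 - v j)) / y) := by
          ring
        simp only [h5, h7, sum_sub_distrib, h4, h6]
        rw [card_insert_of_notMem hk, sum_insert hk, Nat.choose_succ_succ' (#s) 1,
          Nat.choose_one_right]
        push_cast
        ring
  rw [← neg_inj, neg_sub, ← (key s hv).2, ← sum_neg_distrib]
  refine sum_congr rfl fun i hi => ?_
  rw [← mul_prod_erase s _ hi]
  simp only [← sub_eq_add_neg]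
  ring

end Lagrange

section DifferenceProduct

variable {N : ℕ} {K : Type*} [Field K]

/-- The difference product `∏_{i < j} (x_i - x_j)`. -/
def differenceProduct (x : Fin N → K) : K :=
  ∏ i, ∏ j ∈ Ioi i, (x i - x j)

/-- The factors of the difference product that involve the index `i`, up to sign, are the
`x_i - x_j` with `j ≠ i`; the remaining ones do not depend on `x_i`. -/
theorem differenceProduct_eq_mul (x : Fin N → K) (i : Fin N) :
    differenceProduct x = (∏ j ∈ univ.erase i, (x i - x j)) *
      ((∏ j ∈ univ.erase i, if j < i then -1 else 1) *
        ∏ a ∈ univ.erase i, ∏ b ∈ (Ioi a).erase i, (x a - x b)) := by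
  have h1 : ∏ j ∈ Ioi i, (x i - x j) = ∏ j ∈ univ.erase i, if j < i then 1 else (x i - x j) := by
    rw [prod_ite, prod_const_one, one_mul]
    refine prod_congr ?_ fun _ _ => rfl
    ext j
    simp only [mem_Ioi, mem_filter, mem_erase, mem_univ, and_true, not_lt]
    exact ⟨fun h => ⟨h.ne', h.le⟩, fun h => lt_of_le_of_ne h.2 h.1.symm⟩
  have h2 (a : Fin N) : ∏ b ∈ Ioi a, (x a - x b) =
      (if a < i then x a - x i else 1) * ∏ b ∈ (Ioi a).erase i, (x a - x b) := by
    split_ifs with h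
    · rw [mul_prod_erase _ (fun b => x a - x b) (mem_Ioi.mpr h)]
    · rw [erase_eq_of_notMem (by simpa using h), one_mul]
  rw [differenceProduct, ← mul_prod_erase univ _ (mem_univ i), h1,
    prod_congr rfl fun a _ => h2 a, prod_mul_distrib]
  simp only [← prod_mul_distrib]
  refine prod_congr rfl fun j _ => ?_
  split_ifs <;> ring

theorem differenceProduct_update_mul (x : Fin N → K) (i : Fin N) (y : K) :
    differenceProduct (Function.update x i y) * ∏ j ∈ univ.erase i, (x i - x j) =
      differenceProduct x * ∏ j ∈ univ.erase i, (y - x j) := by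
  have h1 : ∏ j ∈ univ.erase i, (Function.update x i y i - Function.update x i y j) =
      ∏ j ∈ univ.erase i, (y - x j) :=
    prod_congr rfl fun j hj => by
      rw [Function.update_self, Function.update_of_ne (ne_of_mem_erase hj)]
  have h2 : ∏ a ∈ univ.erase i, ∏ b ∈ (Ioi a).erase i,
      (Function.update x i y a - Function.update x i y b) =
      ∏ a ∈ univ.erase i, ∏ b ∈ (Ioi a).erase i, (x a - x b) :=
    prod_congr rfl fun a ha => prod_congr rfl fun b hb => by
      rw [Function.update_of_ne (ne_of_mem_erase ha), Function.update_of_ne (ne_of_mem_erase hb)]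
  rw [differenceProduct_eq_mul x i, differenceProduct_eq_mul (Function.update x i y) i, h1, h2]
  ring

theorem differenceProduct_update {x : Fin N → K} (hx : Function.Injective x) (i : Fin N) (y : K) :
    differenceProduct (Function.update x i y) = differenceProduct x *
      ((∏ j ∈ univ.erase i, (y - x j)) / ∏ j ∈ univ.erase i, (x i - x j)) := by
  have h : ∏ j ∈ univ.erase i, (x i - x j) ≠ 0 := prod_ne_zero_iff.mpr fun j hj =>
    sub_ne_zero.mpr fun h => (ne_of_mem_erase hj) (hx h).symm
  rw [← mul_div_assoc, eq_div_iff h, differenceProduct_update_mul]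

theorem differenceProduct_ne_zero {x : Fin N → K} (hx : Function.Injective x) :
    differenceProduct x ≠ 0 :=
  prod_ne_zero_iff.mpr fun _ _ => prod_ne_zero_iff.mpr fun _ hj =>
    sub_ne_zero.mpr fun h => (mem_Ioi.mp hj).ne (hx h)

end DifferenceProduct

section DegreeWeight

variable {N : ℕ}

/-- The number `∏_{i < j} (l_i - l_j) / ∏_i l_i!`. -/
def degreeWeight (l : Fin N → ℕ) : ℚ :=
  differenceProduct (fun i => (l i : ℚ)) / ∏ i, ((l i).factorial : ℚ)

theorem natCast_comp_injective {l : Fin N → ℕ} (hl : Function.Injective l) :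
    Function.Injective fun i => (l i : ℚ) :=
  Nat.cast_injective.comp hl

theorem natCast_update (l : Fin N → ℕ) (i : Fin N) (m : ℕ) :
    (fun j => (Function.update l i m j : ℚ)) = Function.update (fun j => (l j : ℚ)) i (m : ℚ) := by
  funext j
  by_cases h : j = i
  · subst h; simp
  · simp [h]

theorem prod_factorial_update (l : Fin N → ℕ) (i : Fin N) (m : ℕ) :
    (∏ j, ((Function.update l i m j).factorial : ℚ)) * ((l i).factorial : ℚ) =
      (∏ j, ((l j).factorial : ℚ)) * (m.factorial : ℚ) := by
  rw [← mul_prod_erase univ _ (mem_univ i), ← mul_prod_erase univ (fun j => ((l j).factorial : ℚ))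
    (mem_univ i), Function.update_self, prod_congr rfl fun j hj => by
      rw [Function.update_of_ne (ne_of_mem_erase hj)]]
  ring

theorem degreeWeight_update_add_one {l : Fin N → ℕ} (hl : Function.Injective l) (i : Fin N) :
    degreeWeight (Function.update l i (l i + 1)) = degreeWeight l *
      ((∏ j ∈ univ.erase i, ((l i : ℚ) + 1 - l j)) / (∏ j ∈ univ.erase i, ((l i : ℚ) - l j)) /
        ((l i : ℚ) + 1)) := by
  have h := prod_factorial_update l i (l i + 1)
  rw [Nat.factorial_succ] at h
  have h1 : ((l i).factorial : ℚ) ≠ 0 := Nat.cast_ne_zero.mpr (Nat.factorial_ne_zero _)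
  have h2 : (∏ j, ((Function.update l i (l i + 1) j).factorial : ℚ)) =
      (∏ j, ((l j).factorial : ℚ)) * ((l i : ℚ) + 1) := by
    refine mul_right_cancel₀ h1 (h.trans ?_)
    push_cast
    ring
  rw [degreeWeight, degreeWeight, natCast_update, h2,
    differenceProduct_update (natCast_comp_injective hl), Nat.cast_add, Nat.cast_one,
    mul_div_mul_comm]

theorem degreeWeight_update_sub_one {l : Fin N → ℕ} (hl : Function.Injective l) {i : Fin N}
    (hi : l i ≠ 0) :
    degreeWeight (Function.update l i (l i - 1)) = degreeWeight l * ((l i : ℚ) *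
      ((∏ j ∈ univ.erase i, ((l i : ℚ) - 1 - l j)) / (∏ j ∈ univ.erase i, ((l i : ℚ) - l j)))) := by
  have h := prod_factorial_update l i (l i - 1)
  rw [← Nat.mul_factorial_pred hi] at h
  have h1 : ((l i - 1).factorial : ℚ) ≠ 0 := Nat.cast_ne_zero.mpr (Nat.factorial_ne_zero _)
  have h2 : (∏ j, ((l j).factorial : ℚ)) =
      (∏ j, ((Function.update l i (l i - 1) j).factorial : ℚ)) * (l i : ℚ) := by
    refine mul_right_cancel₀ h1 (h.symm.trans ?_)
    push_cast
    ring
  have h3 : (l i : ℚ) ≠ 0 := Nat.cast_ne_zero.mpr hi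
  rw [degreeWeight, degreeWeight, natCast_update, h2,
    differenceProduct_update (natCast_comp_injective hl), Nat.cast_sub (Nat.pos_of_ne_zero hi),
    Nat.cast_one]
  field_simp

theorem sum_degreeWeight_add_one {l : Fin N → ℕ} (hl : Function.Injective l) {k : Fin N}
    (hk : l k = 0) :
    ∑ i, degreeWeight (Function.update l i (l i + 1)) = degreeWeight l := by
  rw [sum_congr rfl fun i _ => degreeWeight_update_add_one hl i, ← mul_sum,
    sum_prod_add_one_sub_div_eq_one (natCast_comp_injective hl).injOn (mem_univ k)
      (by simpa using hk) fun i _ => by positivity, mul_one]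

theorem sum_degreeWeight_sub_one {l : Fin N → ℕ} (hl : Function.Injective l) :
    ∑ i with l i ≠ 0, degreeWeight (Function.update l i (l i - 1)) =
      degreeWeight l * (∑ i, (l i : ℚ) - (N.choose 2 : ℚ)) := by
  have h := sum_mul_prod_sub_one_sub_div (natCast_comp_injective hl).injOn (s := univ)
  rw [card_univ, Fintype.card_fin] at h
  rw [← h, sum_congr rfl fun i hi => degreeWeight_update_sub_one hl (mem_filter.mp hi).2,
    ← mul_sum, sum_filter_of_ne]
  intro i _ hne
  exact fun h0 => hne (by simp [h0])

end DegreeWeight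

end

/-! ### Young diagrams and hook lengths -/

section

open Finset SpechtHook

namespace YoungDiagram

variable {μ ν : YoungDiagram} {N : ℕ}

theorem ext_rowLen (h : ∀ i, μ.rowLen i = ν.rowLen i) : μ = ν := by
  ext ⟨i, j⟩
  simp only [mem_cells, mem_iff_lt_rowLen, h]

theorem exists_rowLen_eq {f : ℕ → ℕ} (hf : Antitone f) (hN : f N = 0) :
    ∃ μ : YoungDiagram, ∀ i, μ.rowLen i = f i := by
  let μ : YoungDiagram :=
    { cells := {c ∈ range N ×ˢ range (f 0) | c.2 < f c.1}
      isLowerSet := by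
        rintro ⟨i, j⟩ ⟨i', j'⟩ hle h
        obtain ⟨hi, hj⟩ := Prod.mk_le_mk.mp hle
        simp only [coe_filter, mem_product, mem_range, Set.mem_ofPred_eq] at h ⊢
        have := hf hi
        omega }
  have hmem (i j : ℕ) : (i, j) ∈ μ ↔ j < f i := by
    change (i, j) ∈ μ.cells ↔ _
    simp only [μ, mem_filter, mem_product, mem_range]
    refine ⟨fun h => h.2, fun h => ⟨⟨?_, h.trans_le (hf i.zero_le)⟩, h⟩⟩
    by_contra! hle
    have := hf hle
    omega
  refine ⟨μ, fun i => ?_⟩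
  exact eq_of_forall_lt_iff fun j => mem_iff_lt_rowLen.symm.trans (hmem i j)

theorem rowLen_eq_zero_of_card_le (h : μ.card ≤ N) : μ.rowLen N = 0 := by
  by_contra hne
  have h1 : (N, 0) ∈ μ := mem_iff_lt_rowLen.mpr (Nat.pos_of_ne_zero hne)
  have h2 := mem_iff_lt_colLen.mp h1
  have h3 : μ.colLen 0 ≤ μ.card := by
    rw [colLen_eq_card]
    exact card_le_card (filter_subset _ _)
  omega

theorem lt_of_rowLen_pos (hN : μ.rowLen N = 0) {i : ℕ} (hi : 0 < μ.rowLen i) : i < N := by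
  by_contra! hle
  have := μ.rowLen_anti N i hle
  omega

theorem prod_cells_eq {M : Type*} [CommMonoid M] (hN : μ.rowLen N = 0) (f : ℕ × ℕ → M) :
    ∏ c ∈ μ.cells, f c = ∏ i : Fin N, ∏ j ∈ range (μ.rowLen i), f (i, j) := by
  rw [prod_finset_product μ.cells (range N) (fun i => range (μ.rowLen i)), prod_range]
  rintro ⟨i, j⟩
  rw [mem_cells, mem_iff_lt_rowLen, mem_range, mem_range]
  exact ⟨fun h => ⟨lt_of_rowLen_pos hN (Nat.zero_lt_of_lt h), h⟩, fun h => h.2⟩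

theorem card_eq_sum_rowLen (hN : μ.rowLen N = 0) : μ.card = ∑ i : Fin N, μ.rowLen i := by
  have h := prod_cells_eq hN fun _ => Multiplicative.ofAdd 1
  simp only [prod_const, card_range, ← ofAdd_nsmul, smul_eq_mul, mul_one] at h
  exact h

theorem exists_cells_eq_insert (hle : μ ≤ ν) (hcard : ν.card = μ.card + 1) :
    ∃ c, c ∉ μ ∧ ν.cells = insert c μ.cells := by
  have hsub : μ.cells ⊆ ν.cells := cells_subset_iff.mpr hle
  obtain ⟨c, hc⟩ := card_eq_one.mp (show #(ν.cells \ μ.cells) = 1 by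
    rw [card_sdiff_of_subset hsub]; change ν.card - μ.card = 1; omega)
  refine ⟨c, fun h => ?_, ?_⟩
  · have : c ∈ ν.cells \ μ.cells := hc ▸ mem_singleton_self c
    exact (mem_sdiff.mp this).2 h
  · rw [insert_eq, ← hc, sdiff_union_of_subset hsub]

/-- The rows of `ν` are those of `μ`, except that row `i` of `ν` is longer by one cell. -/
def AddsCell (μ ν : YoungDiagram) (i : ℕ) : Prop :=
  ∀ r, ν.rowLen r = μ.rowLen r + if r = i then 1 else 0

theorem exists_addsCell (hle : μ ≤ ν) (hcard : ν.card = μ.card + 1) : ∃ i, AddsCell μ ν i := by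
  obtain ⟨c, hc, hins⟩ := exists_cells_eq_insert hle hcard
  refine ⟨c.1, fun r => ?_⟩
  rw [rowLen_eq_card, rowLen_eq_card, row, row, hins, filter_insert]
  by_cases h : c.1 = r
  · rw [if_pos h, if_pos h.symm, card_insert_of_notMem fun hm => hc (mem_filter.mp hm).1]
  · rw [if_neg h, if_neg (Ne.symm h), add_zero]

namespace AddsCell

variable {i j : ℕ}

theorem le (h : AddsCell μ ν i) : μ ≤ ν := by
  rintro ⟨r, s⟩ hrs
  have h1 := mem_iff_lt_rowLen.mp hrs
  have h2 := h r
  exact mem_iff_lt_rowLen.mpr (by omega)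

theorem unique (h : AddsCell μ ν i) (h' : AddsCell μ ν j) : i = j := by
  have h1 := h j
  have h2 := h' j
  rw [if_pos rfl] at h2
  by_contra hne
  rw [if_neg (Ne.symm hne)] at h1
  omega

theorem right_unique {ν' : YoungDiagram} (h : AddsCell μ ν i) (h' : AddsCell μ ν' i) : ν = ν' :=
  ext_rowLen fun r => (h r).trans (h' r).symm

theorem left_unique {μ' : YoungDiagram} (h : AddsCell μ ν i) (h' : AddsCell μ' ν i) : μ = μ' :=
  ext_rowLen fun r => Nat.add_right_cancel ((h r).symm.trans (h' r))

theorem card_eq (h : AddsCell μ ν i) (hν : ν.rowLen N = 0) : ν.card = μ.card + 1 := by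
  have hμ : μ.rowLen N = 0 := by have := h N; omega
  have hi : i < N := lt_of_rowLen_pos hν (by rw [h i, if_pos rfl]; omega)
  rw [card_eq_sum_rowLen hν, card_eq_sum_rowLen hμ, sum_congr rfl fun (r : Fin N) _ => h r,
    sum_add_distrib]
  congr 1
  have : ∀ r : Fin N, ((r : ℕ) = i) = (r = ⟨i, hi⟩) := fun r => by rw [Fin.ext_iff]
  simp [this]

end AddsCell

/-- The shifted row lengths `l_i = μ_i + N - 1 - i`, for `0 ≤ i < N`. -/
def shiftedRow (μ : YoungDiagram) (N : ℕ) (i : Fin N) : ℕ :=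
  μ.rowLen i + (N - 1 - i)

theorem shiftedRow_strictAnti (μ : YoungDiagram) (N : ℕ) : StrictAnti (μ.shiftedRow N) := by
  intro i j hij
  have h1 := μ.rowLen_anti i j (Fin.le_def.mp hij.le)
  have h2 := Fin.lt_def.mp hij
  simp only [shiftedRow]
  omega

theorem sum_shiftedRow (hN : μ.rowLen N = 0) :
    ∑ i, μ.shiftedRow N i = μ.card + N.choose 2 := by
  rw [card_eq_sum_rowLen hN, Nat.choose_two_right, ← sum_range_id, ← sum_range_reflect, sum_range,
    ← sum_add_distrib]
  rfl

theorem AddsCell.shiftedRow_eq {i : Fin N} (h : AddsCell μ ν i) :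
    ν.shiftedRow N = Function.update (μ.shiftedRow N) i (μ.shiftedRow N i + 1) := by
  funext r
  by_cases hr : r = i
  · subst hr
    have := h r
    rw [if_pos rfl] at this
    rw [Function.update_self, shiftedRow, shiftedRow]
    omega
  · have := h r
    rw [if_neg fun h => hr (Fin.ext h)] at this
    rw [Function.update_of_ne hr, shiftedRow, shiftedRow]
    omega

theorem AddsCell.shiftedRow_eq' {i : Fin N} (h : AddsCell μ ν i) :
    μ.shiftedRow N = Function.update (ν.shiftedRow N) i (ν.shiftedRow N i - 1) := by
  rw [h.shiftedRow_eq, Function.update_self, Function.update_idem, Nat.add_sub_cancel,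
    Function.update_eq_self]

theorem hookLength_eq {i j : ℕ} (h : (i, j) ∈ μ) :
    hookLength μ (i, j) = (μ.colLen j - i) + (μ.rowLen i - (j + 1)) := by
  have : hook μ (i, j) = (Ico i (μ.colLen j)).image (·, j) ∪
      (Ico (j + 1) (μ.rowLen i)).image (i, ·) := by
    ext ⟨r, s⟩
    simp only [hook, mem_filter, mem_cells, mem_union, mem_image, mem_Ico, Prod.mk.injEq]
    have hcol : s = j → ((r, s) ∈ μ ↔ r < μ.colLen j) := fun h => by rw [h, mem_iff_lt_colLen]
    have hrow : r = i → ((r, s) ∈ μ ↔ s < μ.rowLen i) := fun h => by rw [h, mem_iff_lt_rowLen]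
    have hi := mem_iff_lt_colLen.mp h
    constructor
    · rintro ⟨hm, ⟨h1, h2⟩ | ⟨h1, h2⟩⟩
      · exact Or.inl ⟨r, ⟨h1, (hcol h2).mp hm⟩, rfl, h2.symm⟩
      · rcases h2.eq_or_lt with h3 | h3
        · exact Or.inl ⟨r, ⟨h1.ge, (hcol h3.symm).mp hm⟩, rfl, h3⟩
        · exact Or.inr ⟨s, ⟨h3, (hrow h1).mp hm⟩, h1.symm, rfl⟩
    · rintro (⟨r, ⟨h1, h2⟩, rfl, rfl⟩ | ⟨s, ⟨h1, h2⟩, rfl, rfl⟩)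
      · exact ⟨(hcol rfl).mpr h2, Or.inl ⟨h1, rfl⟩⟩
      · exact ⟨(hrow rfl).mpr h2, Or.inr ⟨rfl, by omega⟩⟩
  rw [hookLength, this, card_union_of_disjoint, card_image_of_injective, card_image_of_injective,
    Nat.card_Ico, Nat.card_Ico]
  · exact fun _ _ h => (Prod.mk.inj h).2
  · exact fun _ _ h => (Prod.mk.inj h).1
  · rw [disjoint_left]
    simp only [mem_image, mem_Ico]
    rintro ⟨r, s⟩ ⟨a, ha, h1⟩ ⟨b, hb, h2⟩
    simp only [Prod.mk.injEq] at h1 h2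
    omega

/-- The hook lengths of row `i`, together with the differences `l_i - l_k` for `k > i`, are the
numbers `1, …, l_i`. -/
theorem prod_hookLength_row_mul (hN : μ.rowLen N = 0) (i : Fin N) :
    (∏ j ∈ range (μ.rowLen i), hookLength μ (i, j)) *
      ∏ k ∈ Ioi i, (μ.shiftedRow N i - μ.shiftedRow N k) = (μ.shiftedRow N i).factorial := by
  have hhook {j : ℕ} (hj : j < μ.rowLen i) :
      hookLength μ (i, j) = (μ.colLen j - i) + (μ.rowLen i - (j + 1)) ∧
        (i : ℕ) < μ.colLen j ∧ μ.colLen j ≤ N := by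
    have h := mem_iff_lt_rowLen.mpr hj
    refine ⟨hookLength_eq h, mem_iff_lt_colLen.mp h, not_lt.mp fun hlt => ?_⟩
    have := mem_iff_lt_rowLen.mp (mem_iff_lt_colLen.mpr hlt)
    omega
  have hiN := i.2
  have hinj1 : Set.InjOn (fun j => hookLength μ (i, j)) (range (μ.rowLen i)) := by
    have aux : ∀ {a b : ℕ}, a < b → b < μ.rowLen i →
        hookLength μ (i, b) < hookLength μ (i, a) := by
      intro a b hab hb
      have h1 := hhook hb
      have h2 := hhook (hab.trans hb)
      have h3 := μ.colLen_anti a b hab.le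
      omega
    intro a ha b hb hab
    simp only [coe_range, Set.mem_Iio] at ha hb
    simp only at hab
    rcases lt_trichotomy a b with h | h | h
    · have := aux h hb; omega
    · exact h
    · have := aux h ha; omega
  have hinj2 : Set.InjOn (fun k => μ.shiftedRow N i - μ.shiftedRow N k) (Ioi i) := by
    intro a ha b hb hab
    have h1 := μ.shiftedRow_strictAnti N (mem_Ioi.mp (mem_coe.mp ha))
    have h2 := μ.shiftedRow_strictAnti N (mem_Ioi.mp (mem_coe.mp hb))
    simp only at hab
    exact (μ.shiftedRow_strictAnti N).injective (by omega)
  have hdisj : Disjoint ((range (μ.rowLen i)).image fun j => hookLength μ (i, j))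
      ((Ioi i).image fun k => μ.shiftedRow N i - μ.shiftedRow N k) := by
    rw [disjoint_left]
    intro x hx hx'
    obtain ⟨j, hj, rfl⟩ := mem_image.mp hx
    obtain ⟨k, hk, hkj⟩ := mem_image.mp hx'
    have hj := mem_range.mp hj
    have h1 := hhook hj
    have h2 := Fin.lt_def.mp (mem_Ioi.mp hk)
    have h3 := μ.rowLen_anti i k h2.le
    have h4 := k.2
    have h5 : (k : ℕ) < μ.colLen j ↔ j < μ.rowLen k :=
      mem_iff_lt_colLen.symm.trans mem_iff_lt_rowLen
    simp only [shiftedRow] at hkj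
    -- The cell `(k, j)` decides which of the two numbers is larger.
    by_cases h6 : j < μ.rowLen k
    · have := h5.mpr h6
      omega
    · have := mt h5.mp h6
      omega
  rw [← prod_image (f := fun x => x) hinj1, ← prod_image (f := fun x => x) hinj2,
    ← prod_union hdisj, ← prod_Ico_id_eq_factorial]
  refine prod_congr (eq_of_subset_of_card_le (union_subset ?_ ?_) ?_) fun _ _ => rfl
  · intro x hx
    obtain ⟨j, hj, rfl⟩ := mem_image.mp hx
    have h1 := hhook (mem_range.mp hj)
    have := mem_range.mp hj
    rw [mem_Ico, shiftedRow]
    omega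
  · intro x hx
    obtain ⟨k, hk, rfl⟩ := mem_image.mp hx
    have := μ.shiftedRow_strictAnti N (mem_Ioi.mp hk)
    rw [mem_Ico]
    omega
  · rw [card_union_of_disjoint hdisj, card_image_of_injOn hinj1, card_image_of_injOn hinj2,
      card_range, Fin.card_Ioi, Nat.card_Ico, shiftedRow]
    omega

/-- The difference product form and the hook form of the dimension formula agree. -/
theorem degreeWeight_shiftedRow (hN : μ.rowLen N = 0) :
    degreeWeight (μ.shiftedRow N) = (∏ c ∈ μ.cells, (hookLength μ c : ℚ))⁻¹ := by
  have h : (∏ c ∈ μ.cells, (hookLength μ c : ℚ)) *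
      differenceProduct (fun i => (μ.shiftedRow N i : ℚ)) =
      ∏ i, ((μ.shiftedRow N i).factorial : ℚ) := by
    rw [prod_cells_eq hN, differenceProduct, ← prod_mul_distrib]
    refine prod_congr rfl fun i _ => ?_
    rw [← prod_hookLength_row_mul hN i, Nat.cast_mul, Nat.cast_prod, Nat.cast_prod]
    refine congrArg _ (prod_congr rfl fun k hk => ?_)
    rw [Nat.cast_sub (μ.shiftedRow_strictAnti N (mem_Ioi.mp hk)).le]
  have h1 : differenceProduct (fun i => (μ.shiftedRow N i : ℚ)) ≠ 0 :=
    differenceProduct_ne_zero (natCast_comp_injective (μ.shiftedRow_strictAnti N).injective)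
  rw [degreeWeight, ← h, div_mul_cancel_right₀ h1]

end YoungDiagram

end

/-! ### Adding and removing a cell -/

section

open Finset SpechtHook

/-- The Young diagrams with `n` cells. -/
def shapes (n : ℕ) : Finset YoungDiagram :=
  univ.map ⟨diagram (n := n), diagram_injective⟩

theorem mem_shapes {n : ℕ} {μ : YoungDiagram} : μ ∈ shapes n ↔ μ.card = n := by
  simp only [shapes, mem_map, mem_univ, true_and, Function.Embedding.coeFn_mk]
  refine ⟨?_, exists_diagram_eq⟩
  rintro ⟨lam, rfl⟩
  exact card_diagram lam

/-- The reciprocal of the product of the hook lengths. -/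
def hookWeight (μ : YoungDiagram) : ℚ :=
  (∏ c ∈ μ.cells, (hookLength μ c : ℚ))⁻¹

theorem hookLength_pos {μ : YoungDiagram} {c : ℕ × ℕ} (hc : c ∈ μ.cells) : 0 < hookLength μ c :=
  card_pos.mpr ⟨c, mem_filter.mpr ⟨hc, Or.inl ⟨le_rfl, rfl⟩⟩⟩

theorem hookWeight_pos (μ : YoungDiagram) : 0 < hookWeight μ :=
  inv_pos.mpr (prod_pos fun _ hc => Nat.cast_pos.mpr (hookLength_pos hc))

theorem degreeWeight_eq_zero {N : ℕ} {l : Fin N → ℕ} {i j : Fin N} (hij : i ≠ j)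
    (h : l i = l j) : degreeWeight l = 0 := by
  rw [degreeWeight, differenceProduct_eq_mul _ i,
    prod_eq_zero (mem_erase.mpr ⟨hij.symm, mem_univ j⟩) (by rw [h, sub_self]), zero_mul, zero_div]

open YoungDiagram

open Classical in
/-- Summing over the ways to add a cell. A nonzero term of the sum over the rows forces the
enlarged row lengths to be weakly decreasing. -/
theorem sum_hookWeight_upper {n : ℕ} {μ : YoungDiagram} (hμ : μ.card = n) :
    ∑ ν ∈ shapes (n + 1) with μ ≤ ν, hookWeight ν = hookWeight μ := by
  -- One row more than any `ν` can have, so that the last shifted row length of `μ` is zero.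
  have hN {ν : YoungDiagram} (h : ν.card ≤ n + 1) : ν.rowLen (n + 2) = 0 :=
    rowLen_eq_zero_of_card_le (by omega)
  have hl := (μ.shiftedRow_strictAnti (n + 2)).injective
  have hlast : μ.shiftedRow (n + 2) (Fin.last (n + 1)) = 0 := by
    rw [shiftedRow, Fin.val_last, rowLen_eq_zero_of_card_le (by omega)]
    omega
  rw [hookWeight, ← degreeWeight_shiftedRow (hN (by omega)), ← sum_degreeWeight_add_one hl hlast]
  have hex {ν : YoungDiagram} (hν : ν ∈ (shapes (n + 1)).filter (μ ≤ ·)) :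
      ∃ i : Fin (n + 2), AddsCell μ ν i := by
    obtain ⟨h1, h2⟩ := mem_filter.mp hν
    have hcard := mem_shapes.mp h1
    obtain ⟨i, hi⟩ := exists_addsCell h2 (by omega)
    have : i < n + 2 := lt_of_rowLen_pos (hN hcard.le) (by rw [hi i, if_pos rfl]; omega)
    exact ⟨⟨i, this⟩, hi⟩
  refine sum_bij_ne_zero (fun ν hν _ => (hex hν).choose) (fun _ _ _ => mem_univ _)
    (fun ν hν _ ν' hν' _ h => ?_) (fun i _ hi => ?_) fun ν hν _ => ?_
  · have h1 := (hex hν).choose_spec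
    rw [h] at h1
    exact h1.right_unique (hex hν').choose_spec
  · have hanti : Antitone fun r => μ.rowLen r + if r = (i : ℕ) then 1 else 0 := by
      refine antitone_nat_of_succ_le fun r => ?_
      have h1 := μ.rowLen_anti r (r + 1) r.le_succ
      by_cases hr : r + 1 = i
      · rw [if_pos hr, if_neg (by omega)]
        by_contra! hlt
        refine hi (degreeWeight_eq_zero (i := i) (j := ⟨r, by omega⟩) (fun h => ?_) ?_)
        · have := congrArg Fin.val h
          simp only at this
          omega
        · rw [Function.update_self, Function.update_of_ne (fun h => by
            have := congrArg Fin.val h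
            simp only at this
            omega), shiftedRow, shiftedRow]
          simp only [← hr]
          omega
      · rw [if_neg hr]
        omega
    obtain ⟨ν, hν⟩ := exists_rowLen_eq (N := n + 2) hanti (by
      rw [hN (by omega), if_neg (by omega)])
    have hadd : AddsCell μ ν i := hν
    have hνN : ν.rowLen (n + 2) = 0 := by
      rw [hν, hN (by omega), if_neg (by omega)]
    have hmem : ν ∈ (shapes (n + 1)).filter (μ ≤ ·) :=
      mem_filter.mpr ⟨mem_shapes.mpr (by rw [hadd.card_eq hνN, hμ]), hadd.le⟩
    exact ⟨ν, hmem, (hookWeight_pos ν).ne', Fin.ext ((hex hmem).choose_spec.unique hadd)⟩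
  · have hcard := mem_shapes.mp (mem_filter.mp hν).1
    rw [hookWeight, ← degreeWeight_shiftedRow (hN hcard.le), (hex hν).choose_spec.shiftedRow_eq]

open Classical in
/-- Summing over the ways to remove a cell. A nonzero term of the sum over the rows forces the
shortened row to remain at least as long as the next one. -/
theorem sum_hookWeight_lower {n : ℕ} {ν : YoungDiagram} (hν : ν.card = n + 1) :
    ∑ μ ∈ shapes n with μ ≤ ν, hookWeight μ = (n + 1) * hookWeight ν := by
  have hN {μ : YoungDiagram} (h : μ.card ≤ n + 1) : μ.rowLen (n + 1) = 0 :=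
    rowLen_eq_zero_of_card_le h
  have hl := (ν.shiftedRow_strictAnti (n + 1)).injective
  have hsum : ∑ i, (ν.shiftedRow (n + 1) i : ℚ) - ((n + 1).choose 2 : ℚ) = n + 1 := by
    rw [← Nat.cast_sum, sum_shiftedRow (hN hν.le), hν]
    push_cast
    ring
  rw [hookWeight, ← degreeWeight_shiftedRow (hN hν.le), ← hsum, mul_comm,
    ← sum_degreeWeight_sub_one hl]
  have hex {μ : YoungDiagram} (hμ : μ ∈ (shapes n).filter (· ≤ ν)) :
      ∃ i : Fin (n + 1), AddsCell μ ν i := by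
    obtain ⟨h1, h2⟩ := mem_filter.mp hμ
    have hcard := mem_shapes.mp h1
    obtain ⟨i, hi⟩ := exists_addsCell h2 (by omega)
    have : i < n + 1 := lt_of_rowLen_pos (hN hν.le) (by rw [hi i, if_pos rfl]; omega)
    exact ⟨⟨i, this⟩, hi⟩
  refine sum_bij_ne_zero (fun μ hμ _ => (hex hμ).choose) (fun μ hμ _ => ?_)
    (fun μ hμ _ μ' hμ' _ h => ?_) (fun i hmem hi => ?_) fun μ hμ _ => ?_
  · rw [mem_filter, (hex hμ).choose_spec.shiftedRow_eq, Function.update_self]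
    exact ⟨mem_univ _, Nat.succ_ne_zero _⟩
  · have h1 := (hex hμ).choose_spec
    rw [h] at h1
    exact h1.left_unique (hex hμ').choose_spec
  · have h0 := (mem_filter.mp hmem).2
    have hlt : ν.rowLen (i + 1) < ν.rowLen i := by
      by_contra! hle
      have heq := le_antisymm hle (ν.rowLen_anti i (i + 1) (Nat.le_succ _))
      rcases (Nat.le_of_lt_succ i.2).lt_or_eq with hin | hin
      · refine hi (degreeWeight_eq_zero (i := i) (j := ⟨i + 1, by omega⟩) (fun h => ?_) ?_)
        · have := congrArg Fin.val h
          simp only at this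
          omega
        · rw [Function.update_self, Function.update_of_ne (fun h => by
            have := congrArg Fin.val h
            simp only at this
            omega), shiftedRow, shiftedRow]
          simp only [← heq]
          omega
      · rw [shiftedRow, heq, hin, hN hν.le] at h0
        omega
    have hanti : Antitone fun r => ν.rowLen r - if r = (i : ℕ) then 1 else 0 := by
      refine antitone_nat_of_succ_le fun r => ?_
      have h1 := ν.rowLen_anti r (r + 1) r.le_succ
      by_cases hr : r = i
      · rw [if_pos hr, if_neg (by omega), hr]
        omega
      · rw [if_neg hr]
        omega
    obtain ⟨μ, hμ⟩ := exists_rowLen_eq (N := n + 1) hanti (by rw [hN hν.le, Nat.zero_sub])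
    have hadd : AddsCell μ ν i := fun r => by
      rw [hμ]
      split_ifs with h
      · rw [h]; omega
      · rfl
    have hmem : μ ∈ (shapes n).filter (· ≤ ν) :=
      mem_filter.mpr ⟨mem_shapes.mpr (by have := hadd.card_eq (hN hν.le); omega), hadd.le⟩
    exact ⟨μ, hmem, (hookWeight_pos μ).ne', Fin.ext ((hex hmem).choose_spec.unique hadd)⟩
  · have hcard := mem_shapes.mp (mem_filter.mp hμ).1
    rw [hookWeight, ← degreeWeight_shiftedRow (hN (by omega)), (hex hμ).choose_spec.shiftedRow_eq']

open Classical in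
/-- With `F_μ = n! · hookWeight μ`, this is `∑ F_μ² = n!`. Both identities for adding and removing a
cell enter: they count the pairs `μ ≤ ν` of consecutive sizes, weighted by
`hookWeight μ * hookWeight ν`, in two ways. -/
theorem factorial_mul_sum_hookWeight_sq (n : ℕ) :
    (n.factorial : ℚ) * ∑ μ ∈ shapes n, hookWeight μ ^ 2 = 1 := by
  induction n with
  | zero =>
    have h : shapes 0 = {⊥} := by
      ext μ
      rw [mem_shapes, mem_singleton, YoungDiagram.card, card_eq_zero]
      exact ⟨fun h => YoungDiagram.ext h, fun h => by rw [h, cells_bot]⟩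
    simp [h, hookWeight]
  | succ n ih =>
    rw [← ih, Nat.factorial_succ, Nat.cast_mul, mul_comm ((n + 1 : ℕ) : ℚ), mul_assoc, mul_sum]
    congr 1
    calc ∑ ν ∈ shapes (n + 1), ((n + 1 : ℕ) : ℚ) * hookWeight ν ^ 2
        = ∑ ν ∈ shapes (n + 1), ∑ μ ∈ shapes n,
            if μ ≤ ν then hookWeight ν * hookWeight μ else 0 := by
          refine sum_congr rfl fun ν hν => ?_
          rw [← sum_filter, ← mul_sum, sum_hookWeight_lower (mem_shapes.mp hν)]
          push_cast
          ring
      _ = ∑ μ ∈ shapes n, ∑ ν ∈ shapes (n + 1),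
            if μ ≤ ν then hookWeight ν * hookWeight μ else 0 :=
          sum_comm
      _ = ∑ μ ∈ shapes n, hookWeight μ ^ 2 := by
          refine sum_congr rfl fun μ hμ => ?_
          rw [← sum_filter, ← sum_mul, sum_hookWeight_upper (mem_shapes.mp hμ), sq]

theorem snoc_mem_standardTableaux {n : ℕ} {μ ν : YoungDiagram} {t : Fin n → ℕ × ℕ}
    {c : ℕ × ℕ} (ht : t ∈ standardTableaux n μ) (hc : c ∉ μ) (hν : ν.cells = insert c μ.cells) :
    (Fin.snoc t c : Fin (n + 1) → ℕ × ℕ) ∈ standardTableaux (n + 1) ν := by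
  obtain ⟨htab, hstd⟩ := mem_standardTableaux.mp ht
  have hmem (d : ℕ × ℕ) :
      d ∈ ν ↔ ∃ k, (Fin.snoc t c : Fin (n + 1) → ℕ × ℕ) k = d := by
    rw [← mem_cells, hν, mem_insert, mem_cells, htab.mem_iff, Fin.exists_fin_succ']
    simp only [Fin.snoc_castSucc, Fin.snoc_last, or_comm, eq_comm]
  refine mem_standardTableaux.mpr ⟨⟨Fin.snoc_injective_iff.mpr ⟨htab.injective, ?_⟩, hmem⟩, ?_⟩
  · rintro ⟨k, rfl⟩
    exact hc (htab.mem k)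
  · intro k d hd
    induction k using Fin.lastCases with
    | last =>
      rw [Fin.snoc_last] at hd
      have hcν : c ∈ ν := (hmem c).mpr ⟨Fin.last n, Fin.snoc_last _ _⟩
      obtain ⟨j, hj⟩ := (hmem d).mp (ν.isLowerSet hd hcν)
      exact ⟨j, Fin.le_last j, hj⟩
    | cast k =>
      rw [Fin.snoc_castSucc] at hd
      obtain ⟨j, hjk, hj⟩ := hstd k d hd
      exact ⟨j.castSucc, Fin.castSucc_le_castSucc_iff.mpr hjk, by rw [Fin.snoc_castSucc, hj]⟩

open Classical in
/-- The cell of the largest entry can be added to a standard tableau of any shape that `ν` covers.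
-/
theorem sum_card_standardTableaux_le {n : ℕ} {ν : YoungDiagram} (hν : ν.card = n + 1) :
    ∑ μ ∈ shapes n with μ ≤ ν, #(standardTableaux n μ) ≤ #(standardTableaux (n + 1) ν) := by
  have hex (μ : YoungDiagram) (hμ : μ ∈ (shapes n).filter (· ≤ ν)) :
      ∃ c, c ∉ μ ∧ ν.cells = insert c μ.cells :=
    exists_cells_eq_insert (mem_filter.mp hμ).2
      (by rw [hν, mem_shapes.mp (mem_filter.mp hμ).1])
  choose! c hc using hex
  rw [← card_sigma]
  refine card_le_card_of_injOn
    (fun p : (_ : YoungDiagram) × (Fin n → ℕ × ℕ) => (Fin.snoc p.2 (c p.1) : Fin (n + 1) → ℕ × ℕ))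
    (fun p hp => ?_) fun p hp q hq h => ?_
  · obtain ⟨h1, h2⟩ := mem_sigma.mp (mem_coe.mp hp)
    exact snoc_mem_standardTableaux h2 (hc _ h1).1 (hc _ h1).2
  · obtain ⟨μ, t⟩ := p
    obtain ⟨μ', t'⟩ := q
    have hp2 := (mem_sigma.mp (mem_coe.mp hp)).2
    have hq2 := (mem_sigma.mp (mem_coe.mp hq)).2
    obtain rfl : t = t' := (Fin.snoc_injective2 h).1
    obtain rfl : μ = μ' := (mem_standardTableaux.mp hp2).1.shape_eq_of_fst_eq
      (mem_standardTableaux.mp hq2).1 fun _ => rfl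
    rfl

theorem factorial_mul_hookWeight_le_card {n : ℕ} :
    ∀ {μ : YoungDiagram}, μ.card = n →
      (n.factorial : ℚ) * hookWeight μ ≤ #(standardTableaux n μ) := by
  classical
  induction n with
  | zero =>
    intro μ hμ
    have hbot : μ.cells = ∅ := card_eq_zero.mp hμ
    have : (Fin.elim0 : Fin 0 → ℕ × ℕ) ∈ standardTableaux 0 μ :=
      mem_standardTableaux.mpr ⟨⟨fun i => i.elim0, fun c => by
        rw [← mem_cells, hbot]; simp⟩, fun k => k.elim0⟩
    have : 1 ≤ #(standardTableaux 0 μ) := card_pos.mpr ⟨_, this⟩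
    simpa [hookWeight, hbot] using this
  | succ n ih =>
    intro ν hν
    calc ((n + 1).factorial : ℚ) * hookWeight ν
        = ∑ μ ∈ shapes n with μ ≤ ν, (n.factorial : ℚ) * hookWeight μ := by
          rw [← mul_sum, sum_hookWeight_lower hν, Nat.factorial_succ]
          push_cast
          ring
      _ ≤ ∑ μ ∈ shapes n with μ ≤ ν, (#(standardTableaux n μ) : ℚ) :=
          sum_le_sum fun μ hμ => ih (mem_shapes.mp (mem_filter.mp hμ).1)
      _ ≤ #(standardTableaux (n + 1) ν) := by
          exact_mod_cast sum_card_standardTableaux_le hν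

/-- The lower bounds `F_λ ≤ dim V_λ` are equalities, because the squares of both sides have sums
`n!` and at most `n!`. -/
theorem finrank_spechtModule {n : ℕ} (lam : n.Partition) :
    (Module.finrank ℂ (spechtModule lam) : ℚ) = n.factorial * hookWeight (diagram lam) := by
  have hle (lam : n.Partition) : (n.factorial : ℚ) * hookWeight (diagram lam) ≤
      Module.finrank ℂ (spechtModule lam) :=
    (factorial_mul_hookWeight_le_card (card_diagram lam)).trans
      (Nat.cast_le.mpr (card_standardTableaux_le_finrank (isTableau_canonicalTableau lam)))
  have hnonneg (lam : n.Partition) : 0 ≤ (n.factorial : ℚ) * hookWeight (diagram lam) :=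
    mul_nonneg (Nat.cast_nonneg _) (hookWeight_pos _).le
  have hsq (lam : n.Partition) : ((n.factorial : ℚ) * hookWeight (diagram lam)) ^ 2 ≤
      (Module.finrank ℂ (spechtModule lam) : ℚ) ^ 2 :=
    pow_le_pow_left₀ (hnonneg lam) (hle lam) 2
  have h1 : ∑ lam : n.Partition, ((n.factorial : ℚ) * hookWeight (diagram lam)) ^ 2 =
      n.factorial := by
    have h := factorial_mul_sum_hookWeight_sq n
    rw [shapes, sum_map] at h
    simp only [mul_pow]
    rw [← mul_sum, sq, mul_assoc]
    exact (congrArg _ h).trans (mul_one _)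
  have h2 : ∑ lam : n.Partition, (Module.finrank ℂ (spechtModule lam) : ℚ) ^ 2 ≤ n.factorial := by
    exact_mod_cast sum_finrank_spechtModule_sq_le n
  have h3 := (sum_eq_sum_iff_of_le fun lam _ => hsq lam).mp
    (le_antisymm (sum_le_sum fun lam _ => hsq lam) (h2.trans h1.ge)) lam (mem_univ lam)
  exact ((pow_left_inj₀ (hnonneg lam) (Nat.cast_nonneg _) two_ne_zero).mp h3).symm

theorem rowLen_diagram_eq_zero {n N : ℕ} {lam : n.Partition} (hN : lam.parts.card ≤ N) :
    (diagram lam).rowLen N = 0 := by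
  refine Nat.eq_zero_of_not_pos ?_
  rw [← mem_iff_lt_rowLen, diagram, mem_ofRowLens]
  rintro ⟨h, -⟩
  simp only [partList, Multiset.length_sort] at h
  omega

end

/-! ### The hook length formula -/

theorem mainTheorem8 (n : ℕ) (lam : n.Partition) :
    ((Module.finrank ℂ (SpechtHook.spechtModule lam) : ℚ) =
      (n.factorial : ℚ) /
        ∏ c ∈ (SpechtHook.diagram lam).cells,
          (SpechtHook.hookLength (SpechtHook.diagram lam) c : ℚ)) ∧
    (∀ N : ℕ, lam.parts.card ≤ N →
      (Module.finrank ℂ (SpechtHook.spechtModule lam) : ℚ) =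
        (n.factorial : ℚ) / (∏ j : Fin N, ((SpechtHook.shiftedPart lam N j).factorial : ℚ)) *
          ∏ i : Fin N, ∏ j ∈ Finset.Ioi i,
            ((SpechtHook.shiftedPart lam N i : ℚ) - (SpechtHook.shiftedPart lam N j : ℚ))) := by
  refine ⟨by rw [finrank_spechtModule, hookWeight, div_eq_mul_inv], fun N hN => ?_⟩
  rw [finrank_spechtModule, hookWeight,
    ← YoungDiagram.degreeWeight_shiftedRow (rowLen_diagram_eq_zero hN), degreeWeight,
    differenceProduct, mul_div_assoc', div_mul_eq_mul_div]
  rfl
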